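/- Let $(X,\mathcal S,\mu)$ be a probability space and let $\mathfrak B$ be the Banach space of bounded measurable functions $w:X\to\mathbb C$ with the norm $\|w\|=\sup_{x\in X}|w_x|$. Let $\mathbb H=\{z\in\mathbb C:\operatorname{Im}z>0\}$ and $\mathfrak B_+=\{w\in\mathfrak B:\operatorname{Im}w_x>0\text{ for all }x\in X\}$. Let $a\in\mathfrak B$ be real valued and let $S:\mathfrak B\to\mathfrak B$ be a bounded linear operator, with operator norm $\|S\|$, that satisfies **A1** (symmetric and positivity preserving): $\int_X\overline{u_x}\,(Sw)_x\,\mu(dx)=\int_X\overline{(Su)_x}\,w_x\,\mu(dx)$ for all $u,w\in\mathfrak B$, and for every real valued non-negative $p\in\mathfrak B$ the function $Sp$ is real valued with $(Sp)_x\ge 0$ for all $x\in X$. **Theorem (Existence and uniqueness).** For each $z\in\mathbb H$ the quadratic vector equation $$-\frac{1}{m_x}=z+a_x+(Sm)_x\qquad\text{for all }x\in X$$ has a unique solution $m=m(z)\in\mathfrak B_+$, and $z\mapsto m(z)$ is an analytic function from $\mathbb H$ to $\mathfrak B_+\subset\mathfrak B$. Moreover, for each $x\in X$ there is a positive Borel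 measure $v_x$ on $\mathbb R$ with $$\operatorname{supp}v_x\subset[-\Sigma,\Sigma],\quad \Sigma=\|a\|+2\|S\|^{1/2},\qquad v_x(\mathbb R)=\pi,$$ where $\pi=3.14\ldots$, such that $$m_x(z)=\frac1\pi\int_{\mathbb R}\frac{v_x(d\tau)}{\tau-z}\qquad\text{for all }z\in\mathbb H.$$ The map $x\mapsto v_x$ is measurable from $X$ to the space $\mathcal M(\mathbb R)$ of finite Borel measures on $\mathbb R$, where $\mathcal M(\mathbb R)$ carries the Borel $\sigma$-algebra of the weak topology. Furthermore, if $a=0$, then for every $z\in\mathbb H$ the solution $m(z)$ belongs to $L^2(\mu)$ and $$\|m(z)\|_{L^2(\mu)}\le\frac{2}{|z|},$$ and the measures $v_x$ are symmetric: $v_x(-A)=v_x(A)$ for every $x\in X$ and every Borel set $A\subset\mathbb R$. -/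

import Mathlib

open MeasureTheory Set
open scoped ENNReal ComplexConjugate Pointwise

/-- The bounded measurable functions `X → ℂ`, as a subspace of the Banach space of all bounded
functions with the supremum norm. -/
def boundedMeasurable (X : Type*) [MeasurableSpace X] :
    Submodule ℂ (lp (fun _ : X => ℂ) ∞) where
  carrier := {w | Measurable (fun x => w x)}
  add_mem' hu hw := Measurable.add hu hw
  zero_mem' := measurable_const (a := (0 : ℂ))
  smul_mem' c _ hw := Measurable.const_smul hw c

/-- The Banach space of bounded measurable functions `X → ℂ` with the supremum norm. -/
abbrev BMeas (X : Type*) [MeasurableSpace X] : Type _ := ↥(boundedMeasurable X)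

instance BMeas.instCoeFun (X : Type*) [MeasurableSpace X] :
    CoeFun (BMeas X) (fun _ => X → ℂ) where
  coe w := ((w : lp (fun _ : X => ℂ) ∞) : X → ℂ)

/-- The functions in `BMeas X` with values in the open complex upper half-plane. -/
def BMeas.plus (X : Type*) [MeasurableSpace X] : Set (BMeas X) :=
  {w | ∀ x, 0 < (w x).im}

/-- A bounded operator `S` is symmetric with respect to `⟨u, w⟩ = ∫ conj u * w dμ` and positivity
preserving: real non-negative functions are mapped to real non-negative functions. -/
structure IsSymmPosPreserving {X : Type*} [MeasurableSpace X] (μ : Measure X)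
    (S : BMeas X →L[ℂ] BMeas X) : Prop where
  symm : ∀ u w : BMeas X, ∫ x, conj (u x) * S w x ∂μ = ∫ x, conj (S u x) * w x ∂μ
  nonneg : ∀ p : BMeas X, (∀ x, (p x).im = 0 ∧ 0 ≤ (p x).re) →
    ∀ x, (S p x).im = 0 ∧ 0 ≤ (S p x).re

/-- `u` is a solution in `BMeas.plus X` of the quadratic vector equation `-1/u = z + a + S u`
at the spectral parameter `z`. -/
def SolvesQVE {X : Type*} [MeasurableSpace X] (a : BMeas X) (S : BMeas X →L[ℂ] BMeas X)
    (z : ℂ) (u : BMeas X) : Prop :=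
  u ∈ BMeas.plus X ∧ ∀ x, -(1 / u x) = z + a x + S u x

/-! Multiplying out the equation and expanding `m = -∑ z⁻ᵏ⁻¹ Mₖ` at infinity gives a quadratic
recursion for the coefficients (`qveMoment`). Existence amounts to each `k ↦ Mₖ(x)` being the moment
sequence of a probability measure on a compact interval. Its Hankel forms are non-negative because
the equation is one step of a continued fraction: a Hankel form of `M` is a square plus a smaller
Hankel form of `S M` (`hankel_form_eq`), and `S` preserves positivity. A quadratic majorant gives
growth at most `C ρᵏ` for every `ρ > ‖a‖ + 2√‖S‖` (`sum_norm_qveMoment_le`), and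
`IsMomentFunctional.exists_measure` then solves the moment problem on `[-ρ, ρ]`. The Stieltjes
transform satisfies the equation where the series converges, hence on all of the half-plane by the
identity theorem (`solvesQVE_stieltjes`).

Uniqueness: for two solutions `|u - w| / √(Im u Im w)`, a function of the hyperbolic distance, is
bounded, and the equation shrinks any bound for it by a fixed factor (`norm_sub_le_contraction`).

For `a = 0`, testing the symmetry of `S` with `1 / (Im z + S Im u)` gives `∫ |u S u|² ≤ 1`, and `z u
= -1 - u S u` turns this into the L² bound. The odd moments vanish, so the measures are symmetric.
Measurability holds because measures on a fixed compact interval with bounded mass depend weakly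
continuously on their moments. -/

/-! ### The moment problem on a compact interval. -/

section MomentProblem

open Polynomial

/-- A functional on real polynomials that is non-negative on squares and whose moments grow at most
like the powers of `ρ`. -/
structure IsMomentFunctional (ρ : ℝ) (L : ℝ[X] →ₗ[ℝ] ℝ) : Prop where
  sq_nonneg : ∀ q, 0 ≤ L (q * q)
  growth : ∃ C, ∀ k, |L (X ^ k)| ≤ C * ρ ^ k

namespace IsMomentFunctional

variable {ρ : ℝ} {L : ℝ[X] →ₗ[ℝ] ℝ}

theorem growth_mul (hL : IsMomentFunctional ρ L) (g : ℝ[X]) :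
    ∃ C, ∀ k, |L (g * X ^ k)| ≤ C * ρ ^ k := by
  induction g using Polynomial.induction_on' with
  | add p q hp hq =>
    obtain ⟨C, hC⟩ := hp
    obtain ⟨D, hD⟩ := hq
    refine ⟨C + D, fun k => ?_⟩
    rw [add_mul, map_add, add_mul]
    exact (abs_add_le _ _).trans (add_le_add (hC k) (hD k))
  | monomial n c =>
    obtain ⟨C, hC⟩ := hL.growth
    refine ⟨|c| * (C * ρ ^ n), fun k => ?_⟩
    rw [← C_mul_X_pow_eq_monomial, mul_assoc, ← pow_add, ← smul_eq_C_mul, map_smul, smul_eq_mul,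
      abs_mul, mul_assoc, mul_assoc, ← pow_add]
    exact mul_le_mul_of_nonneg_left (hC _) (abs_nonneg _)

theorem comp_mulLeft (hL : IsMomentFunctional ρ L) (g : ℝ[X])
    (hg : ∀ q, 0 ≤ L (g * (q * q))) : IsMomentFunctional ρ (L ∘ₗ LinearMap.mulLeft ℝ g) :=
  ⟨hg, hL.growth_mul g⟩

theorem comp_mulLeft_sq (hL : IsMomentFunctional ρ L) (g : ℝ[X]) :
    IsMomentFunctional ρ (L ∘ₗ LinearMap.mulLeft ℝ (g * g)) :=
  hL.comp_mulLeft _ fun q => by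
    rw [show g * g * (q * q) = (g * q) * (g * q) by ring]
    exact hL.sq_nonneg _

theorem one_nonneg (hL : IsMomentFunctional ρ L) : 0 ≤ L 1 := by
  simpa using hL.sq_nonneg 1

/-- Cauchy–Schwarz, from the discriminant of `t ↦ L ((t + q)²) ≥ 0`. -/
theorem sq_le (hL : IsMomentFunctional ρ L) (q : ℝ[X]) : L q ^ 2 ≤ L 1 * L (q * q) := by
  have h : ∀ t : ℝ, 0 ≤ L 1 * (t * t) + (2 * L q) * t + L (q * q) := fun t => by
    have := hL.sq_nonneg (C t + q)
    rw [show (C t + q) * (C t + q) = (t * t) • (1 : ℝ[X]) + (2 * t) • q + q * q by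
      simp only [smul_eq_C_mul, C_mul, map_ofNat]; ring] at this
    simp only [map_add, map_smul, smul_eq_mul] at this
    linarith
  have := discrim_le_zero h
  unfold discrim at this
  nlinarith

/-- Iterated Cauchy–Schwarz along the powers `2 ^ n`: an excess `|L X| = r ρ L 1` with `r > 1` would
force `L (X ^ 2ⁿ)` to grow like `(r ρ) ^ 2ⁿ`, against the growth bound. The constant in that bound
plays no role in the result. -/
theorem abs_apply_X_le (hρ : 0 < ρ) (hL : IsMomentFunctional ρ L) : |L X| ≤ ρ * L 1 := by
  obtain ⟨C, hC⟩ := hL.growth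
  rcases hL.one_nonneg.eq_or_lt with h0 | h0
  · have := hL.sq_le X
    rw [← h0, zero_mul] at this
    rw [← h0, pow_eq_zero_iff (two_ne_zero) |>.1 (le_antisymm this (_root_.sq_nonneg _))]
    simp
  · by_contra! hlt
    set r := |L X| / (ρ * L 1) with hr
    have hr1 : 1 < r := (one_lt_div (by positivity)).2 hlt
    have key : ∀ n : ℕ, L 1 * (r * ρ) ^ (2 ^ n) ≤ |L (X ^ (2 ^ n))| := fun n => by
      induction n with
      | zero =>
        rw [pow_zero, pow_one, pow_one, hr]
        apply le_of_eq
        field_simp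
      | succ n ih =>
        have h1 := hL.sq_le (X ^ (2 ^ n))
        rw [← pow_add, ← two_mul, ← pow_succ'] at h1
        have h2 : (L 1 * (r * ρ) ^ (2 ^ n)) ^ 2 ≤ L (X ^ 2 ^ n) ^ 2 := by
          rw [← sq_abs (L (X ^ 2 ^ n))]
          exact pow_le_pow_left₀ (by positivity) ih 2
        have h3 : L 1 * (L 1 * (r * ρ) ^ (2 ^ (n + 1))) ≤ L 1 * L (X ^ 2 ^ (n + 1)) := by
          refine le_trans (le_of_eq ?_) (h2.trans h1)
          rw [pow_succ 2 n, pow_mul]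
          ring
        exact (le_of_mul_le_mul_left h3 h0).trans (le_abs_self _)
    obtain ⟨N, hN⟩ := pow_unbounded_of_one_lt (C / L 1) hr1
    have h4 := (key N).trans (hC (2 ^ N))
    rw [mul_pow, ← mul_assoc] at h4
    have h5 := le_of_mul_le_mul_right h4 (by positivity)
    have h6 : r ^ N ≤ r ^ 2 ^ N := pow_le_pow_right₀ hr1.le Nat.lt_two_pow_self.le
    rw [div_lt_iff₀ h0] at hN
    nlinarith

/-- The bound `|L X| ≤ ρ L 1` applied to the functional `p ↦ L (q² p)` makes `L ((ρ - X) q²)`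
non-negative; `comp_add` is the mirror image. -/
theorem comp_sub (hρ : 0 < ρ) (hL : IsMomentFunctional ρ L) :
    IsMomentFunctional ρ (L ∘ₗ LinearMap.mulLeft ℝ (C ρ - X)) :=
  hL.comp_mulLeft _ fun q => by
    have h := (le_abs_self _).trans ((hL.comp_mulLeft_sq q).abs_apply_X_le hρ)
    simp only [LinearMap.comp_apply, LinearMap.mulLeft_apply, mul_one] at h
    rw [sub_mul, map_sub, ← smul_eq_C_mul, map_smul, smul_eq_mul, mul_comm X]
    linarith

theorem comp_add (hρ : 0 < ρ) (hL : IsMomentFunctional ρ L) :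
    IsMomentFunctional ρ (L ∘ₗ LinearMap.mulLeft ℝ (C ρ + X)) :=
  hL.comp_mulLeft _ fun q => by
    have h := (neg_abs_le _).trans' (neg_le_neg ((hL.comp_mulLeft_sq q).abs_apply_X_le hρ))
    simp only [LinearMap.comp_apply, LinearMap.mulLeft_apply, mul_one] at h
    rw [add_mul, map_add, ← smul_eq_C_mul, map_smul, smul_eq_mul, mul_comm X]
    linarith

end IsMomentFunctional

theorem Polynomial.eval_nonneg_of_nonneg_on_ne {ρ c : ℝ} (hρ : 0 < ρ) {r : ℝ[X]}
    (h : ∀ t ∈ Icc (-ρ) ρ, t ≠ c → 0 ≤ r.eval t) : ∀ t ∈ Icc (-ρ) ρ, 0 ≤ r.eval t := by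
  have hcl : IsClosed {t : ℝ | 0 ≤ r.eval t} := isClosed_le continuous_const r.continuous
  have h1 : Ioo (-ρ) ρ ∩ {c}ᶜ ⊆ {t : ℝ | 0 ≤ r.eval t} := fun t ht =>
    h t (Ioo_subset_Icc_self ht.1) ht.2
  have h2 := hcl.closure_subset_iff.2 h1
  have h3 : Ioo (-ρ) ρ ⊆ closure (Ioo (-ρ) ρ ∩ {c}ᶜ) :=
    (dense_compl_singleton c).open_subset_closure_inter isOpen_Ioo
  have h4 := closure_mono h3
  rw [closure_Ioo (by linarith), closure_closure] at h4
  exact h4.trans h2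

/-- Subtract the minimum over the interval, so that `p` acquires a root there. A root at an endpoint
splits off a factor `ρ ± X`, an interior one is double and splits off a square. Each factor can be
absorbed into the functional, and the degree drops; hence the induction must range over all `L`. -/
theorem IsMomentFunctional.nonneg_of_nonneg_on {ρ : ℝ} (hρ : 0 < ρ) (p : ℝ[X]) :
    ∀ {L : ℝ[X] →ₗ[ℝ] ℝ}, IsMomentFunctional ρ L → (∀ t ∈ Icc (-ρ) ρ, 0 ≤ p.eval t) →
      0 ≤ L p := by
  induction hn : p.natDegree using Nat.strong_induction_on generalizing p with
  | _ n ih =>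
  intro L hL hp
  rcases Nat.eq_zero_or_pos n with h0 | hpos
  · rw [eq_C_of_natDegree_eq_zero (hn.trans h0)] at hp ⊢
    have := hp 0 ⟨by linarith, hρ.le⟩
    rw [eval_C] at this
    rw [← mul_one (C (p.coeff 0)), ← smul_eq_C_mul, map_smul]
    exact mul_nonneg this hL.one_nonneg
  obtain ⟨c, hc, hmin⟩ := isCompact_Icc.exists_isMinOn (nonempty_Icc.2 (by linarith : -ρ ≤ ρ))
    p.continuous.continuousOn
  set q := p - C (p.eval c) with hq
  have hqn : q.natDegree = n := by rw [hq, natDegree_sub_C, hn]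
  have hq0 : ∀ t ∈ Icc (-ρ) ρ, 0 ≤ q.eval t := fun t ht => by
    rw [hq, eval_sub, eval_C, sub_nonneg]; exact hmin ht
  have hqc : q.IsRoot c := by simp [hq]
  suffices h : 0 ≤ L q by
    have h1 : p = q + (p.eval c) • (1 : ℝ[X]) := by rw [hq, smul_eq_C_mul]; ring
    rw [h1, map_add, map_smul]
    exact add_nonneg h (mul_nonneg (hp c hc) hL.one_nonneg)
  obtain ⟨r, hr⟩ := dvd_iff_isRoot.2 hqc
  have hr0 : r ≠ 0 := by rintro rfl; simp at hr; rw [hr] at hqn; simp at hqn; omega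
  have hrn : r.natDegree + 1 = n := by
    rw [← hqn, hr, natDegree_mul (X_sub_C_ne_zero c) hr0, natDegree_X_sub_C, add_comm]
  have hev : ∀ t, q.eval t = (t - c) * r.eval t := fun t => by rw [hr]; simp
  rcases hc.1.eq_or_lt with h1 | h1
  · have hrn' : ∀ t ∈ Icc (-ρ) ρ, 0 ≤ r.eval t := by
      refine Polynomial.eval_nonneg_of_nonneg_on_ne (c := c) hρ fun t ht htc => ?_
      have hlt : 0 < t - c := sub_pos.2 (lt_of_le_of_ne (h1 ▸ ht.1) htc.symm)
      exact nonneg_of_mul_nonneg_right ((hev t) ▸ hq0 t ht) hlt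
    have := ih _ (by omega) r rfl (hL.comp_add hρ) hrn'
    rwa [LinearMap.comp_apply, LinearMap.mulLeft_apply,
      show (C ρ + X) * r = q by rw [hr, ← h1, C_neg]; ring] at this
  rcases hc.2.eq_or_lt with h2 | h2
  · have hrn' : ∀ t ∈ Icc (-ρ) ρ, 0 ≤ (-r).eval t := by
      refine Polynomial.eval_nonneg_of_nonneg_on_ne (c := c) hρ fun t ht htc => ?_
      have hlt : 0 < c - t := sub_pos.2 (lt_of_le_of_ne (h2 ▸ ht.2) htc)
      have h3 := hq0 t ht
      rw [hev] at h3
      rw [eval_neg]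
      exact nonneg_of_mul_nonneg_right (by linarith) hlt
    have := ih _ (by omega) (-r) (natDegree_neg r) (hL.comp_sub hρ) hrn'
    rwa [LinearMap.comp_apply, LinearMap.mulLeft_apply,
      show (C ρ - X) * -r = q by rw [hr, ← h2]; ring] at this
  · have hrc : r.IsRoot c := by
      -- At an interior minimum the derivative of `q = (X - c) r` vanishes, and its value there is
      -- `r.eval c`.
      have hloc : IsLocalMin (fun t => q.eval t) c := by
        filter_upwards [Ioo_mem_nhds h1 h2] with t ht
        rw [hqc.eq_zero]
        exact hq0 t (Ioo_subset_Icc_self ht)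
      have hd := hloc.deriv_eq_zero
      rw [Polynomial.deriv, hr] at hd
      simpa using hd
    obtain ⟨s, hs⟩ := dvd_iff_isRoot.2 hrc
    have hs0 : s ≠ 0 := by rintro rfl; simp at hs; exact hr0 hs
    have hsn : s.natDegree + 1 = r.natDegree := by
      rw [hs, natDegree_mul (X_sub_C_ne_zero c) hs0, natDegree_X_sub_C, add_comm]
    have hsn' : ∀ t ∈ Icc (-ρ) ρ, 0 ≤ s.eval t := by
      refine Polynomial.eval_nonneg_of_nonneg_on_ne (c := c) hρ fun t ht htc => ?_
      have h3 := hq0 t ht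
      rw [hev, hs, eval_mul, ← mul_assoc, eval_sub, eval_X, eval_C] at h3
      exact nonneg_of_mul_nonneg_right h3 (mul_self_pos.2 (sub_ne_zero.2 htc))
    have := ih _ (by omega) s rfl (hL.comp_mulLeft_sq (X - C c)) hsn'
    rwa [LinearMap.comp_apply, LinearMap.mulLeft_apply,
      show (X - C c) * (X - C c) * s = q by rw [hr, hs]; ring] at this

open scoped CompactlySupported in
-- Riesz extension on pairs (polynomial, continuous function on `K`), ordered by the sign of their
-- sum on `K`. The second component of the extension is a positive functional, represented by a
-- measure.
theorem IsMomentFunctional.exists_measure {ρ : ℝ} (hρ : 0 < ρ) {L : ℝ[X] →ₗ[ℝ] ℝ}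
    (hL : IsMomentFunctional ρ L) :
    ∃ ν : Measure ℝ, IsFiniteMeasure ν ∧ ν (Icc (-ρ) ρ)ᶜ = 0 ∧
      ∀ p : ℝ[X], ∫ t, p.eval t ∂ν = L p := by
  let K := Icc (-ρ) ρ
  let s : PointedCone ℝ (ℝ[X] × C_c(K, ℝ)) :=
    { carrier := {e | ∀ t : K, 0 ≤ e.1.eval (t : ℝ) + e.2 t}
      zero_mem' := by simp
      add_mem' := fun {e e'} he he' t => by
        have h1 := he t
        have h2 := he' t
        simp only [Prod.fst_add, Prod.snd_add, eval_add, CompactlySupportedContinuousMap.add_apply]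
        linarith
      smul_mem' := fun c e he t => by
        have h := mul_nonneg c.2 (he t)
        simp only [Prod.smul_fst, Prod.smul_snd]
        rw [mul_add] at h
        rw [eval_smul]
        exact h }
  let f : (ℝ[X] × C_c(K, ℝ)) →ₗ.[ℝ] ℝ :=
    ⟨Submodule.prod ⊤ ⊥, L ∘ₗ LinearMap.fst ℝ _ _ ∘ₗ Submodule.subtype _⟩
  have hfp : ∀ p : ℝ[X], ((p, 0) : ℝ[X] × C_c(K, ℝ)) ∈ f.domain := fun p => ⟨trivial, rfl⟩
  obtain ⟨g, hgf, hgs⟩ := riesz_extension s f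
    (fun x hx => by
      refine hL.nonneg_of_nonneg_on hρ _ fun t ht => ?_
      have h1 := hx ⟨t, ht⟩
      have h2 : x.1.2 = 0 := x.2.2
      rw [h2] at h1
      simpa using h1)
    (fun y => by
      -- Constants are cofinal: minus a lower bound of the sum on the compact `K` moves any pair
      -- into the cone.
      have hcont : Continuous fun t : K => y.1.eval (t : ℝ) + y.2 t := by fun_prop
      obtain ⟨B, hB⟩ := (isCompact_range hcont).bddBelow
      refine ⟨⟨(C (-B), 0), hfp _⟩, fun t => ?_⟩
      have := hB (mem_range_self t)
      simp only [Prod.fst_add, Prod.snd_add, eval_add, CompactlySupportedContinuousMap.add_apply,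
        eval_C, CompactlySupportedContinuousMap.zero_apply]
      linarith)
  let Λ : C_c(K, ℝ) →ₚ[ℝ] ℝ := PositiveLinearMap.mk₀ (g ∘ₗ LinearMap.inr ℝ _ _) fun φ hφ =>
    hgs _ fun t => by simpa using hφ t
  refine ⟨(RealRMK.rieszMeasure Λ).map Subtype.val, inferInstance, ?_, fun p => ?_⟩
  · rw [Measure.map_apply measurable_subtype_coe measurableSet_Icc.compl]
    simp [K]
  · let φ : C_c(K, ℝ) :=
      ⟨⟨fun t => p.eval (t : ℝ), by fun_prop⟩, HasCompactSupport.of_compactSpace _⟩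
    have hφ : ∀ t, φ t = p.eval (t : ℝ) := fun t => rfl
    -- A polynomial and its restriction cancel on `K`, so both signs of the pair lie in the cone and
    -- the extension agrees on the two.
    have h1 : 0 ≤ g (-p, φ) := hgs _ fun t => by simp [hφ]
    have h2 : 0 ≤ g (p, -φ) := hgs _ fun t => by simp [hφ]
    have h3 : g (p, 0) = L p := hgf ⟨(p, 0), hfp p⟩
    have h4 : g (-p, φ) = Λ φ - L p := by
      rw [← h3, show ((-p, φ) : ℝ[X] × C_c(K, ℝ)) = (0, φ) - (p, 0) by simp, map_sub]
      rfl
    have h5 : g (p, -φ) = L p - Λ φ := by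
      rw [← h3, show ((p, -φ) : ℝ[X] × C_c(K, ℝ)) = (p, 0) - (0, φ) by simp, map_sub]
      rfl
    rw [integral_map (by fun_prop) (by fun_prop)]
    have h6 := RealRMK.integral_rieszMeasure Λ φ
    simp only [hφ] at h6
    rw [h6]
    linarith

end MomentProblem

/-! ### Compactly supported measures are controlled by their moments. -/

section CompactSupport

open Polynomial Filter Topology

/-- The linear functional on real polynomials with prescribed moments. -/
noncomputable def momentFunctional (c : ℕ → ℝ) : ℝ[X] →ₗ[ℝ] ℝ :=
  Polynomial.lsum fun k => c k • (LinearMap.id : ℝ →ₗ[ℝ] ℝ)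

theorem momentFunctional_smul_X_pow (c : ℕ → ℝ) (r : ℝ) (k : ℕ) :
    momentFunctional c (r • X ^ k) = r * c k := by
  rw [smul_X_eq_monomial, momentFunctional, lsum_apply, sum_monomial_index]
  · simp [mul_comm]
  · simp

theorem momentFunctional_X_pow (c : ℕ → ℝ) (k : ℕ) : momentFunctional c (X ^ k) = c k := by
  simpa using momentFunctional_smul_X_pow c 1 k

theorem isMomentFunctional_momentFunctional {ρ : ℝ} {c : ℕ → ℝ}
    (hpos : ∀ (n : ℕ) (d : ℕ → ℝ),
      0 ≤ ∑ i ∈ Finset.range n, ∑ j ∈ Finset.range n, d i * d j * c (i + j))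
    (hgrowth : ∃ C, ∀ k, |c k| ≤ C * ρ ^ k) : IsMomentFunctional ρ (momentFunctional c) where
  sq_nonneg q := by
    have h : q * q = ∑ i ∈ Finset.range (q.natDegree + 1), ∑ j ∈ Finset.range (q.natDegree + 1),
        (q.coeff i * q.coeff j) • X ^ (i + j) := by
      conv_lhs => rw [q.as_sum_range_C_mul_X_pow]
      rw [Finset.sum_mul_sum]
      refine Finset.sum_congr rfl fun i _ => Finset.sum_congr rfl fun j _ => ?_
      rw [smul_eq_C_mul, C_mul, pow_add]
      ring
    rw [h]
    simp only [map_sum, momentFunctional_smul_X_pow]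
    exact hpos _ _
  growth := by simpa only [momentFunctional_X_pow] using hgrowth

theorem exists_measure_of_moments {ρ : ℝ} (hρ : 0 < ρ) {c : ℕ → ℝ}
    (hpos : ∀ (n : ℕ) (d : ℕ → ℝ),
      0 ≤ ∑ i ∈ Finset.range n, ∑ j ∈ Finset.range n, d i * d j * c (i + j))
    (hgrowth : ∃ C, ∀ k, |c k| ≤ C * ρ ^ k) :
    ∃ ν : Measure ℝ, IsFiniteMeasure ν ∧ ν (Icc (-ρ) ρ)ᶜ = 0 ∧ ∀ k, ∫ t, t ^ k ∂ν = c k := by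
  obtain ⟨ν, h1, h2, h3⟩ := (isMomentFunctional_momentFunctional hpos hgrowth).exists_measure hρ
  refine ⟨ν, h1, h2, fun k => ?_⟩
  rw [← momentFunctional_X_pow c k, ← h3]
  simp

theorem ContinuousOn.integrable_of_measure_compl_eq_zero {ν : Measure ℝ} [IsFiniteMeasure ν]
    {ρ : ℝ} (hν : ν (Icc (-ρ) ρ)ᶜ = 0) {E : Type*} [NormedAddCommGroup E] {f : ℝ → E}
    (hf : ContinuousOn f (Icc (-ρ) ρ)) : Integrable f ν := by
  rw [← Measure.restrict_eq_self_of_ae_mem (s := Icc (-ρ) ρ) (μ := ν) hν]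
  exact hf.integrableOn_compact isCompact_Icc

theorem abs_integral_sub_integral_le {ν : Measure ℝ} [IsFiniteMeasure ν] {ρ ε : ℝ}
    (hν : ν (Icc (-ρ) ρ)ᶜ = 0) {f g : ℝ → ℝ} (hf : Continuous f) (hg : Continuous g)
    (h : ∀ t ∈ Icc (-ρ) ρ, |f t - g t| ≤ ε) :
    |∫ t, f t ∂ν - ∫ t, g t ∂ν| ≤ ε * ν.real univ := by
  rw [← integral_sub (hf.continuousOn.integrable_of_measure_compl_eq_zero hν)
    (hg.continuousOn.integrable_of_measure_compl_eq_zero hν)]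
  rw [← Real.norm_eq_abs]
  refine norm_integral_le_of_norm_le_const ?_
  have : ∀ᵐ t ∂ν, t ∈ Icc (-ρ) ρ := hν
  filter_upwards [this] with t ht using h t ht

theorem integral_polynomial_eval {ν : Measure ℝ} [IsFiniteMeasure ν] {ρ : ℝ}
    (hν : ν (Icc (-ρ) ρ)ᶜ = 0) (p : ℝ[X]) :
    ∫ t, p.eval t ∂ν = ∑ k ∈ Finset.range (p.natDegree + 1), p.coeff k * ∫ t, t ^ k ∂ν := by
  simp only [eval_eq_sum_range]
  rw [integral_finsetSum]
  · simp only [integral_const_mul]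
  · exact fun k _ => ContinuousOn.integrable_of_measure_compl_eq_zero hν (by fun_prop)

/-- A measure with compact support is determined by its moments. -/
theorem MeasureTheory.Measure.ext_of_moments {ν ν' : Measure ℝ} [IsFiniteMeasure ν]
    [IsFiniteMeasure ν'] {ρ : ℝ} (hν : ν (Icc (-ρ) ρ)ᶜ = 0) (hν' : ν' (Icc (-ρ) ρ)ᶜ = 0)
    (h : ∀ k : ℕ, ∫ t, t ^ k ∂ν = ∫ t, t ^ k ∂ν') : ν = ν' := by
  refine ext_of_forall_integral_eq_of_IsFiniteMeasure fun f => ?_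
  refine eq_of_forall_dist_le fun ε hε => ?_
  -- The extra `1` keeps the division legitimate when both measures are zero.
  set B := ν.real univ + ν'.real univ + 1 with hB
  have hB0 : 0 < B := by positivity
  obtain ⟨p, hp⟩ := exists_polynomial_near_of_continuousOn (-ρ) ρ f f.continuous.continuousOn
    (ε / B) (by positivity)
  have h1 := abs_integral_sub_integral_le hν p.continuous f.continuous fun t ht => (hp t ht).le
  have h2 := abs_integral_sub_integral_le hν' p.continuous f.continuous fun t ht => (hp t ht).le
  have h3 : ∫ t, p.eval t ∂ν = ∫ t, p.eval t ∂ν' := by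
    simp only [integral_polynomial_eval hν, integral_polynomial_eval hν', h]
  rw [h3] at h1
  rw [Real.dist_eq]
  have h4 : ε / B * (ν.real univ + ν'.real univ) ≤ ε := by
    rw [div_mul_eq_mul_div, div_le_iff₀ hB0, hB]
    nlinarith
  rw [abs_le] at *
  constructor <;> linarith [h1.1, h1.2, h2.1, h2.2]

/-- By Weierstrass, the integrals are limits, uniform in `x`, of finite linear combinations of
moments, which are continuous for the topology induced by the moment map. -/
theorem continuous_induced_moments_integral {X : Type*} {v : X → Measure ℝ}
    [∀ x, IsFiniteMeasure (v x)] {ρ B : ℝ} (hv : ∀ x, v x (Icc (-ρ) ρ)ᶜ = 0)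
    (hB : ∀ x, (v x).real univ ≤ B) {f : ℝ → ℝ} (hf : Continuous f) :
    Continuous[.induced (fun x (k : ℕ) => ∫ t, t ^ k ∂(v x)) inferInstance, inferInstance]
      fun x => ∫ t, f t ∂(v x) := by
  let _ : TopologicalSpace X := .induced (fun x (k : ℕ) => ∫ t, t ^ k ∂(v x)) inferInstance
  refine continuous_of_uniform_approx_of_continuous fun u hu => ?_
  obtain ⟨ε, hε, hu⟩ := Metric.mem_uniformity_dist.1 hu
  obtain ⟨p, hp⟩ := exists_polynomial_near_of_continuousOn (-ρ) ρ f hf.continuousOn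
    (ε / (|B| + 1)) (by positivity)
  refine ⟨fun x => ∫ t, p.eval t ∂(v x), ?_, fun x => hu ?_⟩
  · simp only [fun x => integral_polynomial_eval (hv x)]
    refine continuous_finsetSum _ fun k _ => continuous_const.mul ?_
    have h1 : Continuous fun x (k : ℕ) => ∫ t, t ^ k ∂(v x) := continuous_induced_dom
    exact (continuous_apply k).comp h1
  · rw [dist_comm, Real.dist_eq]
    refine (abs_integral_sub_integral_le (hv x) p.continuous hf
      fun t ht => (hp t ht).le).trans_lt ?_
    rw [div_mul_eq_mul_div, div_lt_iff₀ (by positivity)]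
    have := (hB x).trans (le_abs_self B)
    nlinarith

/-- The preimage of an open set is `φ ⁻¹' V` with `V` open in `ι → ℝ`, and for countable `ι` the
Borel sets there form the product σ-algebra. Thus no countability of `Y` is needed, which suits the
weak topology. -/
theorem measurable_of_continuous_induced {X ι : Type*} [Countable ι] [MeasurableSpace X]
    {Y : Type*} [TopologicalSpace Y] {φ : X → ι → ℝ} (hφ : ∀ k, Measurable fun x => φ x k)
    {g : X → Y} (hg : Continuous[.induced φ inferInstance, inferInstance] g) :
    Measurable[_, borel Y] g := by
  refine @measurable_generateFrom _ _ _ _ _ fun U hU => ?_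
  obtain ⟨V, hV, hVU⟩ := isOpen_induced_iff.1 (@IsOpen.preimage _ _ (_) _ _ hg _ hU)
  rw [← hVU]
  exact measurable_pi_lambda _ hφ hV.measurableSet

variable {X : Type*} [MeasurableSpace X]

theorem measurable_integral_of_moments {v : X → Measure ℝ}
    [∀ x, IsFiniteMeasure (v x)] {ρ B : ℝ} (hv : ∀ x, v x (Icc (-ρ) ρ)ᶜ = 0)
    (hB : ∀ x, (v x).real univ ≤ B) (hm : ∀ k : ℕ, Measurable fun x => ∫ t, t ^ k ∂(v x))
    {f : ℝ → ℝ} (hf : Continuous f) : Measurable fun x => ∫ t, f t ∂(v x) := by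
  have := measurable_of_continuous_induced hm (continuous_induced_moments_integral hv hB hf)
  rwa [← BorelSpace.measurable_eq] at this

theorem measurable_integral_of_moments_complex {v : X → Measure ℝ}
    [∀ x, IsFiniteMeasure (v x)] {ρ B : ℝ} (hv : ∀ x, v x (Icc (-ρ) ρ)ᶜ = 0)
    (hB : ∀ x, (v x).real univ ≤ B) (hm : ∀ k : ℕ, Measurable fun x => ∫ t, t ^ k ∂(v x))
    {f : ℝ → ℂ} (hf : Continuous f) : Measurable fun x => ∫ t, f t ∂(v x) := by
  have h : ∀ x, ∫ t, f t ∂(v x) =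
      ((∫ t, (f t).re ∂(v x) : ℝ) : ℂ) + ((∫ t, (f t).im ∂(v x) : ℝ) : ℂ) * Complex.I := fun x =>
    (integral_re_add_im (𝕜 := ℂ)
      (hf.continuousOn.integrable_of_measure_compl_eq_zero (hv x))).symm
  simp only [h]
  refine .add ?_ (.mul_const ?_ _) <;> refine Complex.measurable_ofReal.comp ?_
  · exact measurable_integral_of_moments hv hB hm (Complex.continuous_re.comp hf)
  · exact measurable_integral_of_moments hv hB hm (Complex.continuous_im.comp hf)

theorem measurable_finiteMeasure_of_moments {v : X → FiniteMeasure ℝ} {ρ B : ℝ}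
    (hv : ∀ x, (v x : Measure ℝ) (Icc (-ρ) ρ)ᶜ = 0)
    (hB : ∀ x, (v x : Measure ℝ).real univ ≤ B)
    (hm : ∀ k : ℕ, Measurable fun x => ∫ t, t ^ k ∂(v x : Measure ℝ)) :
    Measurable[_, borel (FiniteMeasure ℝ)] v := by
  refine measurable_of_continuous_induced hm ?_
  let _ : TopologicalSpace X :=
    .induced (fun x (k : ℕ) => ∫ t, t ^ k ∂(v x : Measure ℝ)) inferInstance
  refine continuous_iff_continuousAt.2 fun x =>
    FiniteMeasure.tendsto_iff_forall_integral_tendsto.2 fun f => ?_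
  exact (continuous_induced_moments_integral (v := fun x => (v x : Measure ℝ)) hv hB
    f.continuous).tendsto x

end CompactSupport

/-! ### The Banach space, positive operators and the coefficients at infinity. -/

section BoundedMeasurable

variable {X : Type*} [MeasurableSpace X]

namespace BMeas

theorem ext {u w : BMeas X} (h : ∀ x, u x = w x) : u = w :=
  Subtype.ext (lp.ext (funext h))

theorem measurable (w : BMeas X) : Measurable fun x => w x := w.2

theorem norm_apply_le (w : BMeas X) (x : X) : ‖w x‖ ≤ ‖w‖ :=
  lp.norm_apply_le_norm ENNReal.top_ne_zero w.1 x

theorem norm_le {w : BMeas X} {C : ℝ} (hC : 0 ≤ C) (h : ∀ x, ‖w x‖ ≤ C) : ‖w‖ ≤ C :=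
  lp.norm_le_of_forall_le hC h

@[simp] theorem add_apply (u w : BMeas X) (x : X) : (u + w) x = u x + w x := rfl
@[simp] theorem sub_apply (u w : BMeas X) (x : X) : (u - w) x = u x - w x := rfl
@[simp] theorem neg_apply (u : BMeas X) (x : X) : (-u) x = -u x := rfl
@[simp] theorem zero_apply (x : X) : (0 : BMeas X) x = 0 := rfl
@[simp] theorem smul_apply (c : ℂ) (u : BMeas X) (x : X) : (c • u) x = c * u x := rfl

/-- The bounded measurable function given by a function with a bound. -/
def mk (f : X → ℂ) (hf : Measurable f) (C : ℝ) (hC : ∀ x, ‖f x‖ ≤ C) : BMeas X :=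
  ⟨⟨f, memℓp_infty ⟨C, by rintro _ ⟨x, rfl⟩; exact hC x⟩⟩, hf⟩

@[simp] theorem mk_apply (f : X → ℂ) (hf : Measurable f) (C : ℝ) (hC : ∀ x, ‖f x‖ ≤ C) (x : X) :
    mk f hf C hC x = f x := rfl

/-- The bounded measurable function given by a real function with a bound. -/
noncomputable def ofReal (f : X → ℝ) (hf : Measurable f) (C : ℝ) (hC : ∀ x, |f x| ≤ C) : BMeas X :=
  mk (fun x => (f x : ℂ)) (Complex.measurable_ofReal.comp hf) C (by simpa using hC)

@[simp] theorem ofReal_apply (f : X → ℝ) (hf : Measurable f) (C : ℝ) (hC : ∀ x, |f x| ≤ C)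
    (x : X) : ofReal f hf C hC x = f x := rfl

/-- The pointwise real part. -/
noncomputable def rePart (u : BMeas X) : BMeas X :=
  ofReal (fun x => (u x).re) (Complex.measurable_re.comp u.measurable) ‖u‖
    fun x => (Complex.abs_re_le_norm _).trans (u.norm_apply_le x)

/-- The pointwise imaginary part. -/
noncomputable def imPart (u : BMeas X) : BMeas X :=
  ofReal (fun x => (u x).im) (Complex.measurable_im.comp u.measurable) ‖u‖
    fun x => (Complex.abs_im_le_norm _).trans (u.norm_apply_le x)

@[simp] theorem rePart_apply (u : BMeas X) (x : X) : u.rePart x = (u x).re := rfl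
@[simp] theorem imPart_apply (u : BMeas X) (x : X) : u.imPart x = (u x).im := rfl

theorem rePart_add_imPart (u : BMeas X) : u = u.rePart + Complex.I • u.imPart :=
  ext fun x => by
    rw [add_apply, smul_apply, rePart_apply, imPart_apply, mul_comm, Complex.re_add_im]

/-- The pointwise product. -/
noncomputable def mul (u w : BMeas X) : BMeas X :=
  mk (fun x => u x * w x) (u.measurable.mul w.measurable) (‖u‖ * ‖w‖) fun x => by
    rw [norm_mul]
    exact mul_le_mul (u.norm_apply_le x) (w.norm_apply_le x) (norm_nonneg _) (norm_nonneg _)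

@[simp] theorem mul_apply (u w : BMeas X) (x : X) : u.mul w x = u x * w x := rfl

theorem norm_mul_le (u w : BMeas X) : ‖u.mul w‖ ≤ ‖u‖ * ‖w‖ :=
  norm_le (by positivity) fun x => by
    rw [mul_apply, norm_mul]
    exact mul_le_mul (u.norm_apply_le x) (w.norm_apply_le x) (norm_nonneg _) (norm_nonneg _)

/-- The constant function. -/
noncomputable def const (X : Type*) [MeasurableSpace X] (c : ℝ) : BMeas X :=
  ofReal (fun _ => c) measurable_const |c| fun _ => le_rfl

@[simp] theorem const_apply (c : ℝ) (x : X) : const X c x = c := rfl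

theorem norm_const_one_le : ‖const X 1‖ ≤ 1 := norm_le zero_le_one fun x => by simp

/-- Evaluation at a point. -/
noncomputable def eval (x : X) : BMeas X →L[ℂ] ℂ :=
  LinearMap.mkContinuous
    { toFun := fun w => w x, map_add' := fun _ _ => rfl, map_smul' := fun _ _ => rfl } 1
    fun w => by rw [one_mul]; exact w.norm_apply_le x

@[simp] theorem eval_apply (x : X) (w : BMeas X) : eval x w = w x := rfl

@[simp] theorem sum_apply {ι : Type*} (s : Finset ι) (f : ι → BMeas X) (x : X) :
    (∑ i ∈ s, f i) x = ∑ i ∈ s, f i x := map_sum (eval x) f s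

/-- Measurability survives pointwise limits, so the subspace is closed. Completeness is used to sum
the expansion in norm and to pass from differentiability to analyticity. -/
instance : CompleteSpace (BMeas X) := by
  refine IsClosed.completeSpace_coe (hs := ?_)
  refine IsSeqClosed.isClosed fun u w hu huw => ?_
  have h : ∀ x, Filter.Tendsto (fun n => u n x) Filter.atTop (nhds (w x)) := fun x => by
    rw [tendsto_iff_norm_sub_tendsto_zero] at huw ⊢
    exact squeeze_zero (fun _ => norm_nonneg _)
      (fun n => lp.norm_apply_le_norm ENNReal.top_ne_zero (u n - w) x) huw
  exact measurable_of_tendsto_metrizable (fun n => hu n) (tendsto_pi_nhds.2 h)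

end BMeas

namespace IsSymmPosPreserving

variable {μ : Measure X} {S : BMeas X →L[ℂ] BMeas X} (hS : IsSymmPosPreserving μ S)

include hS

/-- A real `p` is the difference of the non-negative functions `p + ‖p‖` and `‖p‖`. -/
theorem im_eq_zero {p : BMeas X} (hp : ∀ x, (p x).im = 0) (x : X) : (S p x).im = 0 := by
  have h1 := (hS.nonneg (p + BMeas.const X ‖p‖) (fun y => ⟨by
    rw [BMeas.add_apply, BMeas.const_apply, Complex.add_im, hp, Complex.ofReal_im, add_zero], by
    have := (neg_abs_le _).trans'
      (neg_le_neg ((Complex.abs_re_le_norm _).trans (p.norm_apply_le y)))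
    simp only [BMeas.add_apply, BMeas.const_apply, Complex.add_re, Complex.ofReal_re]
    linarith⟩) x).1
  have h2 := (hS.nonneg (BMeas.const X ‖p‖) (fun y => ⟨by simp, by simp⟩) x).1
  rw [S.map_add, BMeas.add_apply, Complex.add_im, h2, add_zero] at h1
  exact h1

theorem re_mono {p q : BMeas X} (hp : ∀ x, (p x).im = 0) (hq : ∀ x, (q x).im = 0)
    (h : ∀ x, (p x).re ≤ (q x).re) (x : X) : (S p x).re ≤ (S q x).re := by
  have := (hS.nonneg (q - p) (fun y =>
    ⟨by rw [BMeas.sub_apply, Complex.sub_im, hp, hq, sub_zero], by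
      rw [BMeas.sub_apply, Complex.sub_re]; exact sub_nonneg.2 (h y)⟩) x).2
  rwa [S.map_sub, BMeas.sub_apply, Complex.sub_re, sub_nonneg] at this

theorem re_apply (u : BMeas X) (x : X) : (S u x).re = (S u.rePart x).re := by
  conv_lhs => rw [u.rePart_add_imPart]
  rw [S.map_add, S.map_smul, BMeas.add_apply, BMeas.smul_apply]
  simp [-BMeas.rePart_apply, hS.im_eq_zero (p := u.imPart) (fun _ => Complex.ofReal_im _) x]

theorem im_apply (u : BMeas X) (x : X) : (S u x).im = (S u.imPart x).re := by
  conv_lhs => rw [u.rePart_add_imPart]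
  rw [S.map_add, S.map_smul, BMeas.add_apply, BMeas.smul_apply]
  simp [hS.im_eq_zero (p := u.rePart) (fun _ => Complex.ofReal_im _) x]

/-- Rotate `u` by a unimodular constant that makes `S u x` real and non-negative; the real part of
the rotated function is still at most `p`. -/
theorem norm_apply_le {u p : BMeas X} (hp : ∀ x, (p x).im = 0) (h : ∀ x, ‖u x‖ ≤ (p x).re)
    (x : X) : ‖S u x‖ ≤ (S p x).re := by
  obtain ⟨c, hc, hcu⟩ : ∃ c : ℂ, ‖c‖ = 1 ∧ c * S u x = ‖S u x‖ := by
    obtain ⟨c, hc, h⟩ := RCLike.exists_norm_eq_mul_self (S u x)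
    exact ⟨c, hc, h.symm⟩
  have h1 : ‖S u x‖ = (S (c • u) x).re := by
    rw [S.map_smul, BMeas.smul_apply, hcu, Complex.ofReal_re]
  rw [h1, hS.re_apply]
  refine hS.re_mono (fun y => by simp) hp (fun y => ?_) x
  refine le_trans ?_ (h y)
  rw [BMeas.rePart_apply, Complex.ofReal_re, BMeas.smul_apply]
  refine (Complex.re_le_norm _).trans ?_
  rw [norm_mul, hc, one_mul]

end IsSymmPosPreserving

/-- The coefficients of the expansion of the solution of `-1/m = z + a + S m` at infinity, that is
`m = -∑ z⁻ᵏ⁻¹ Mₖ`. -/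
noncomputable def qveMoment (a : BMeas X) (S : BMeas X →L[ℂ] BMeas X) : ℕ → BMeas X
  | 0 => BMeas.const X 1
  | n + 1 => -(a.mul (qveMoment a S n)) +
      ∑ i : Fin n, (qveMoment a S i).mul (S (qveMoment a S (n - 1 - i)))

theorem qveMoment_zero_apply (a : BMeas X) (S : BMeas X →L[ℂ] BMeas X) (x : X) :
    qveMoment a S 0 x = 1 := by
  rw [qveMoment]; simp

/-- The recursion compares coefficients in `z m + a m + m (S m) = -1`. Since `i < n`, the natural
subtraction `n - 1 - i` never truncates; `Fin n` in the definition records this for termination. -/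
theorem qveMoment_succ (a : BMeas X) (S : BMeas X →L[ℂ] BMeas X) (n : ℕ) :
    qveMoment a S (n + 1) = -(a.mul (qveMoment a S n)) +
      ∑ i ∈ Finset.range n, (qveMoment a S i).mul (S (qveMoment a S (n - 1 - i))) := by
  rw [qveMoment, Finset.sum_range]

theorem qveMoment_succ_apply (a : BMeas X) (S : BMeas X →L[ℂ] BMeas X) (n : ℕ) (x : X) :
    qveMoment a S (n + 1) x = -(a x * qveMoment a S n x) +
      ∑ i ∈ Finset.range n, qveMoment a S i x * S (qveMoment a S (n - 1 - i)) x := by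
  rw [qveMoment_succ, BMeas.add_apply, BMeas.neg_apply, BMeas.sum_apply]
  rfl

/-- The Hankel matrix of the sequence `M` obtained from `N` by the continued fraction step
`-1/M(z) = z + a + N(z)`. -/
theorem hankel_eq {a : ℝ} {M N : ℕ → ℝ} (h0 : M 0 = 1)
    (h : ∀ n, M (n + 1) = -(a * M n) + ∑ i ∈ Finset.range n, M i * N (n - 1 - i)) (i : ℕ) :
    ∀ j, M (i + j) = M i * M j + ∑ l ∈ Finset.range i, ∑ k ∈ Finset.range j,
      M l * M k * N ((i - 1 - l) + (j - 1 - k)) := by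
  induction i with
  | zero => intro j; simp [h0]
  | succ i ih =>
    intro j
    -- One unit moves from `i` to `j`. Expanding `M (j + 1)` and `M (i + 1)` by the recursion
    -- produces exactly the boundary terms `l = i` and `k = j`, and the two `a`-terms agree.
    rw [show i + 1 + j = i + (j + 1) by ring, ih (j + 1), Finset.sum_range_succ, h j, h i]
    simp only [Finset.sum_range_succ _ j, Finset.sum_add_distrib]
    have e1 : ∑ l ∈ Finset.range i, ∑ k ∈ Finset.range j,
          M l * M k * N (i - 1 - l + (j + 1 - 1 - k)) =
        ∑ l ∈ Finset.range i, ∑ k ∈ Finset.range j,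
          M l * M k * N (i + 1 - 1 - l + (j - 1 - k)) := by
      refine Finset.sum_congr rfl fun l hl => Finset.sum_congr rfl fun k hk => ?_
      rw [Finset.mem_range] at hl hk
      congr 2
      omega
    rw [e1]
    have e2 : ∑ l ∈ Finset.range i, M l * M j * N (i - 1 - l + (j + 1 - 1 - j)) =
        M j * ∑ l ∈ Finset.range i, M l * N (i - 1 - l) := by
      rw [Finset.mul_sum]
      refine Finset.sum_congr rfl fun l _ => ?_
      rw [show i - 1 - l + (j + 1 - 1 - j) = i - 1 - l by omega]
      ring
    have e3 : ∑ k ∈ Finset.range j, M i * M k * N (i + 1 - 1 - i + (j - 1 - k)) =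
        M i * ∑ k ∈ Finset.range j, M k * N (j - 1 - k) := by
      rw [Finset.mul_sum]
      refine Finset.sum_congr rfl fun l _ => ?_
      rw [show i + 1 - 1 - i + (j - 1 - l) = j - 1 - l by omega]
      ring
    rw [e2, e3]
    ring

/-- The Hankel form of `M` is a square plus a Hankel form of `N` of smaller size. -/
theorem hankel_form_eq {a : ℝ} {M N : ℕ → ℝ} (h0 : M 0 = 1)
    (h : ∀ n, M (n + 1) = -(a * M n) + ∑ i ∈ Finset.range n, M i * N (n - 1 - i)) (n : ℕ)
    (d : ℕ → ℝ) :
    ∃ e : ℕ → ℝ, ∑ i ∈ Finset.range (n + 1), ∑ j ∈ Finset.range (n + 1), d i * d j * M (i + j) =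
      (∑ i ∈ Finset.range (n + 1), d i * M i) ^ 2 +
        ∑ i ∈ Finset.range n, ∑ j ∈ Finset.range n, e i * e j * N (i + j) := by
  -- Reversing both sums makes the index of `N` depend on `l + k` alone, the Hankel shape.
  have hrefl : ∀ i j, ∑ l ∈ Finset.range i, ∑ k ∈ Finset.range j,
      M l * M k * N ((i - 1 - l) + (j - 1 - k)) =
      ∑ l ∈ Finset.range i, ∑ k ∈ Finset.range j,
        M (i - 1 - l) * M (j - 1 - k) * N (l + k) := fun i j => by
    rw [← Finset.sum_range_reflect]
    refine Finset.sum_congr rfl fun l hl => ?_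
    rw [← Finset.sum_range_reflect]
    refine Finset.sum_congr rfl fun k hk => ?_
    rw [Finset.mem_range] at hl hk
    congr 2
    omega
  -- Extending the inner ranges to a common length by zeros allows the sums to be interchanged; the
  -- new coefficients are `e l = ∑_{i > l} d i * M (i - 1 - l)`.
  have hext : ∀ i ∈ Finset.range (n + 1), ∀ f : ℕ → ℝ, ∑ l ∈ Finset.range i, f l =
      ∑ l ∈ Finset.range n, if l < i then f l else 0 := fun i hi f => by
    rw [← Finset.sum_filter]
    refine Finset.sum_congr ?_ fun _ _ => rfl
    ext l
    simp only [Finset.mem_range, Finset.mem_filter] at hi ⊢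
    omega
  refine ⟨fun l => ∑ i ∈ Finset.range (n + 1), if l < i then d i * M (i - 1 - l) else 0, ?_⟩
  have h1 : ∀ i ∈ Finset.range (n + 1), ∀ j ∈ Finset.range (n + 1),
      d i * d j * M (i + j) = (d i * M i) * (d j * M j) +
        ∑ l ∈ Finset.range n, ∑ k ∈ Finset.range n, (if l < i then d i * M (i - 1 - l) else 0) *
          (if k < j then d j * M (j - 1 - k) else 0) * N (l + k) := fun i hi j hj => by
    rw [hankel_eq h0 h i j, hrefl, hext i hi, mul_add, Finset.mul_sum]
    congr 1
    · ring
    · refine Finset.sum_congr rfl fun l _ => ?_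
      rw [hext j hj]
      split_ifs
      · rw [Finset.mul_sum]
        refine Finset.sum_congr rfl fun k _ => ?_
        split_ifs <;> ring
      · simp
  rw [Finset.sum_congr rfl fun i hi => Finset.sum_congr rfl fun j hj => h1 i hi j hj]
  simp only [Finset.sum_add_distrib]
  congr 1
  · rw [sq, Finset.sum_mul_sum]
  · have hcomm : ∀ f : ℕ → ℕ → ℕ → ℕ → ℝ,
        ∑ i ∈ Finset.range (n + 1), ∑ j ∈ Finset.range (n + 1),
          ∑ l ∈ Finset.range n, ∑ k ∈ Finset.range n, f i j l k =
        ∑ l ∈ Finset.range n, ∑ k ∈ Finset.range n,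
          ∑ i ∈ Finset.range (n + 1), ∑ j ∈ Finset.range (n + 1), f i j l k := fun f => by
      rw [Finset.sum_congr rfl fun i _ => Finset.sum_comm]
      rw [Finset.sum_comm]
      refine Finset.sum_congr rfl fun l _ => ?_
      rw [Finset.sum_congr rfl fun i _ => Finset.sum_comm]
      rw [Finset.sum_comm]
    rw [hcomm]
    refine Finset.sum_congr rfl fun l _ => Finset.sum_congr rfl fun k _ => ?_
    rw [Finset.sum_mul_sum, Finset.sum_mul]
    exact Finset.sum_congr rfl fun i _ => (Finset.sum_mul ..).symm

end BoundedMeasurable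

/-! ### Positivity, growth and representing measures of the coefficients. -/

section Moments

variable {X : Type*} [MeasurableSpace X] {μ : Measure X} {a : BMeas X} {S : BMeas X →L[ℂ] BMeas X}

theorem BMeas.map_sum {ι : Type*} (S : BMeas X →L[ℂ] BMeas X) (s : Finset ι) (f : ι → BMeas X) :
    S (∑ i ∈ s, f i) = ∑ i ∈ s, S (f i) :=
  _root_.map_sum (S : BMeas X →ₗ[ℂ] BMeas X) f s

theorem qveMoment_im (ha : ∀ x, (a x).im = 0) (hS : IsSymmPosPreserving μ S) (n : ℕ) :
    ∀ x, (qveMoment a S n x).im = 0 := by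
  induction n using Nat.strong_induction_on with
  | _ n ih =>
    intro x
    rcases n with _ | n
    · rw [qveMoment_zero_apply, Complex.one_im]
    · rw [qveMoment_succ_apply, Complex.add_im, Complex.neg_im, Complex.mul_im, ha,
        ih n n.lt_succ_self, Complex.im_sum, Finset.sum_eq_zero]
      · simp
      · intro i hi
        rw [Finset.mem_range] at hi
        rw [Complex.mul_im, ih i (by omega), hS.im_eq_zero (ih (n - 1 - i) (by omega))]
        simp

theorem qveMoment_succ_re (ha : ∀ x, (a x).im = 0) (hS : IsSymmPosPreserving μ S) (x : X) (n : ℕ) :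
    (qveMoment a S (n + 1) x).re = -((a x).re * (qveMoment a S n x).re) +
      ∑ i ∈ Finset.range n,
        (qveMoment a S i x).re * (S (qveMoment a S (n - 1 - i)) x).re := by
  rw [qveMoment_succ_apply, Complex.add_re, Complex.neg_re, Complex.mul_re, ha, Complex.re_sum,
    zero_mul, sub_zero]
  congr 1
  refine Finset.sum_congr rfl fun i _ => ?_
  rw [Complex.mul_re, qveMoment_im ha hS, zero_mul, sub_zero]

/-- With the coefficients `e` fixed, the smaller Hankel form at `x` is `S` applied to the function
`y ↦` (Hankel form of the `Mₖ(y)`), which is non-negative at every `y` by induction. Hence `d` and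
`x` stay quantified. -/
theorem qveMoment_hankel_nonneg (ha : ∀ x, (a x).im = 0) (hS : IsSymmPosPreserving μ S) (n : ℕ) :
    ∀ (d : ℕ → ℝ) (x : X), 0 ≤ ∑ i ∈ Finset.range n, ∑ j ∈ Finset.range n,
      d i * d j * (qveMoment a S (i + j) x).re := by
  induction n with
  | zero => simp
  | succ n ih =>
    intro d x
    obtain ⟨e, he⟩ := hankel_form_eq (M := fun k => (qveMoment a S k x).re)
      (N := fun k => (S (qveMoment a S k) x).re) (by simp [qveMoment_zero_apply])
      (qveMoment_succ_re ha hS x) n d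
    rw [he]
    refine add_nonneg (sq_nonneg _) ?_
    have key := (hS.nonneg (∑ i ∈ Finset.range n, ∑ j ∈ Finset.range n,
      ((e i * e j : ℝ) : ℂ) • qveMoment a S (i + j)) (fun y => ?_) x).2
    · simp only [BMeas.map_sum S, S.map_smul, BMeas.sum_apply, BMeas.smul_apply, Complex.re_sum,
        Complex.re_ofReal_mul] at key
      exact key
    · simp only [BMeas.sum_apply, BMeas.smul_apply, Complex.re_sum, Complex.im_sum,
        Complex.re_ofReal_mul, Complex.im_ofReal_mul, qveMoment_im ha hS, mul_zero,
        Finset.sum_const_zero, true_and]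
      exact ih e y

theorem sum_range_conv_le {g : ℕ → ℝ} (hg : ∀ i, 0 ≤ g i) (n : ℕ) :
    ∑ k ∈ Finset.range n, ∑ i ∈ Finset.range k, g i * g (k - 1 - i) ≤
      (∑ i ∈ Finset.range n, g i) ^ 2 := by
  rcases n with _ | n
  · simp
  rw [Finset.sum_range_succ', Finset.range_zero, Finset.sum_empty, add_zero]
  simp only [Nat.add_sub_cancel]
  rw [Finset.sum_range_diag_flip n fun i j => g i * g j, sq, Finset.sum_mul_sum]
  refine (Finset.sum_le_sum fun i _ => ?_).trans
    (Finset.sum_le_sum_of_subset_of_nonneg (Finset.range_mono n.le_succ) fun i _ _ =>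
      Finset.sum_nonneg fun j _ => mul_nonneg (hg i) (hg j))
  exact Finset.sum_le_sum_of_subset_of_nonneg (Finset.range_mono (by omega))
    fun j _ _ => mul_nonneg (hg i) (hg j)

/-- With `ρ = ‖a‖ + 2 σ`, the partial sums satisfy `Gₙ₊₁ ≤ (1 + ‖a‖ Gₙ + σ² Gₙ²) / ρ`, and `1 / σ`
is a fixed point of the right-hand side. This is the source of the radius `‖a‖ + 2√‖S‖`. -/
theorem sum_norm_qveMoment_le {σ : ℝ} (hσ : 0 < σ) (hSσ : ‖S‖ ≤ σ ^ 2) (n : ℕ) :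
    ∑ k ∈ Finset.range n, ‖qveMoment a S k‖ / (‖a‖ + 2 * σ) ^ (k + 1) ≤ 1 / σ := by
  set ρ := ‖a‖ + 2 * σ with hρ
  have hρ0 : 0 < ρ := by positivity
  set g : ℕ → ℝ := fun k => ‖qveMoment a S k‖ / ρ ^ (k + 1) with hg
  have hg0 : ∀ k, 0 ≤ g k := fun k => by positivity
  change ∑ k ∈ Finset.range n, g k ≤ 1 / σ
  induction n with
  | zero => simp; positivity
  | succ n ih =>
    rw [Finset.sum_range_succ']
    have h0 : g 0 ≤ 1 / ρ := by
      rw [hg]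
      simp only [zero_add, pow_one, qveMoment]
      gcongr
      exact BMeas.norm_const_one_le
    have h1 : ∀ k, g (k + 1) ≤ ‖a‖ / ρ * g k +
        σ ^ 2 / ρ * ∑ i ∈ Finset.range k, g i * g (k - 1 - i) := fun k => by
      have hn : ‖qveMoment a S (k + 1)‖ ≤ ‖a‖ * ‖qveMoment a S k‖ +
          ∑ i ∈ Finset.range k, ‖qveMoment a S i‖ * (σ ^ 2 * ‖qveMoment a S (k - 1 - i)‖) := by
        rw [qveMoment_succ]
        refine (norm_add_le _ _).trans (add_le_add ?_ ?_)
        · rw [norm_neg]; exact BMeas.norm_mul_le _ _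
        · refine (norm_sum_le _ _).trans (Finset.sum_le_sum fun i _ => ?_)
          refine (BMeas.norm_mul_le _ _).trans (mul_le_mul_of_nonneg_left ?_ (norm_nonneg _))
          exact (S.le_opNorm _).trans (mul_le_mul_of_nonneg_right hSσ (norm_nonneg _))
      simp only [hg]
      rw [div_le_iff₀ (by positivity)]
      refine hn.trans (le_of_eq ?_)
      rw [add_mul, Finset.mul_sum, Finset.sum_mul]
      congr 1
      · rw [pow_succ ρ (k + 1)]
        field_simp
      · refine Finset.sum_congr rfl fun i hi => ?_
        rw [Finset.mem_range] at hi
        have : ρ ^ (k + 1 + 1) = ρ * (ρ ^ (i + 1) * ρ ^ (k - 1 - i + 1)) := by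
          rw [← pow_add, ← pow_succ']
          congr 1
          omega
        rw [this]
        field_simp
    have h2 : ∑ k ∈ Finset.range n, g (k + 1) ≤ ‖a‖ / ρ * (1 / σ) + σ ^ 2 / ρ * (1 / σ) ^ 2 := by
      refine (Finset.sum_le_sum fun k _ => h1 k).trans ?_
      rw [Finset.sum_add_distrib, ← Finset.mul_sum, ← Finset.mul_sum]
      gcongr
      refine (sum_range_conv_le hg0 n).trans ?_
      exact pow_le_pow_left₀ (Finset.sum_nonneg fun i _ => hg0 i) ih 2
    refine (add_le_add h2 h0).trans (le_of_eq ?_)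
    rw [hρ]
    field_simp
    ring

theorem norm_qveMoment_le {σ : ℝ} (hσ : 0 < σ) (hSσ : ‖S‖ ≤ σ ^ 2) (k : ℕ) :
    ‖qveMoment a S k‖ ≤ (‖a‖ + 2 * σ) / σ * (‖a‖ + 2 * σ) ^ k := by
  have hρ0 : 0 < ‖a‖ + 2 * σ := by positivity
  have h1 := sum_norm_qveMoment_le (a := a) hσ hSσ (k + 1)
  have h2 := Finset.single_le_sum (f := fun k => ‖qveMoment a S k‖ / (‖a‖ + 2 * σ) ^ (k + 1))
    (fun i _ => by positivity) (Finset.self_mem_range_succ k)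
  have h3 := h2.trans h1
  rw [div_le_iff₀ (by positivity)] at h3
  refine h3.trans (le_of_eq ?_)
  rw [pow_succ]
  field_simp

theorem exists_norm_qveMoment_le {ρ : ℝ} (hρ : ‖a‖ + 2 * Real.sqrt ‖S‖ < ρ) :
    ∃ C, ∀ k, ‖qveMoment a S k‖ ≤ C * ρ ^ k := by
  have h0 := Real.sqrt_nonneg ‖S‖
  -- The choice `σ = (ρ - ‖a‖) / 2` is positive even when `S = 0`, thanks to the strict inequality
  -- for `ρ`.
  have hσ : Real.sqrt ‖S‖ < (ρ - ‖a‖) / 2 := by linarith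
  have h := norm_qveMoment_le (a := a) (h0.trans_lt hσ)
    ((Real.sqrt_le_left (h0.trans hσ.le)).1 hσ.le)
  rw [show ‖a‖ + 2 * ((ρ - ‖a‖) / 2) = ρ by ring] at h
  exact ⟨_, h⟩

/-- The indices of the two factors in each summand add up to an odd number, so one of them is odd.
-/
theorem qveMoment_odd_eq_zero (h : a = 0) (k : ℕ) : qveMoment a S (2 * k + 1) = 0 := by
  induction k using Nat.strong_induction_on with
  | _ k ih =>
    refine BMeas.ext fun x => ?_
    rw [qveMoment_succ_apply, h, BMeas.zero_apply, zero_mul, neg_zero, zero_add]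
    refine Finset.sum_eq_zero fun i hi => ?_
    rw [Finset.mem_range] at hi
    rcases Nat.even_or_odd' i with ⟨j, rfl | rfl⟩
    · rw [← h, show 2 * k - 1 - 2 * j = 2 * (k - 1 - j) + 1 by omega, ih _ (by omega), S.map_zero,
        BMeas.zero_apply, mul_zero]
    · rw [← h, ih _ (by omega), BMeas.zero_apply, zero_mul]

/-- Each `ρ` above the critical radius yields its own measure; equality of moments makes them all
coincide, so a single measure serves every `ρ`. -/
theorem exists_qveMeasure (ha : ∀ x, (a x).im = 0) (hS : IsSymmPosPreserving μ S) :
    ∃ ν : X → Measure ℝ, ∀ x, IsFiniteMeasure (ν x) ∧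
      (∀ ρ, ‖a‖ + 2 * Real.sqrt ‖S‖ < ρ → ν x (Icc (-ρ) ρ)ᶜ = 0) ∧
      ∀ k, ∫ t, t ^ k ∂(ν x) = (qveMoment a S k x).re := by
  have hex : ∀ (x : X) (ρ : ℝ), ‖a‖ + 2 * Real.sqrt ‖S‖ < ρ → ∃ ν : Measure ℝ,
      IsFiniteMeasure ν ∧ ν (Icc (-ρ) ρ)ᶜ = 0 ∧
        ∀ k, ∫ t, t ^ k ∂ν = (qveMoment a S k x).re := fun x ρ hρ => by
    refine exists_measure_of_moments (hρ.trans_le' (by positivity))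
      (fun n d => qveMoment_hankel_nonneg ha hS n d x) ?_
    obtain ⟨C, hC⟩ := exists_norm_qveMoment_le hρ
    exact ⟨C, fun k => (Complex.abs_re_le_norm _).trans ((BMeas.norm_apply_le _ x).trans (hC k))⟩
  have h1 : ‖a‖ + 2 * Real.sqrt ‖S‖ < ‖a‖ + 2 * Real.sqrt ‖S‖ + 1 := lt_add_one _
  choose ν hfin hnull hmom using fun x => hex x _ h1
  refine ⟨ν, fun x => ⟨hfin x, fun ρ hρ => ?_, hmom x⟩⟩
  obtain ⟨ν', hfin', hnull', hmom'⟩ := hex x ρ hρ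
  have hmono : ∀ {κ : Measure ℝ} {s : ℝ}, κ (Icc (-s) s)ᶜ = 0 →
      s ≤ max ρ (‖a‖ + 2 * Real.sqrt ‖S‖ + 1) →
      κ (Icc (-max ρ (‖a‖ + 2 * Real.sqrt ‖S‖ + 1))
        (max ρ (‖a‖ + 2 * Real.sqrt ‖S‖ + 1)))ᶜ = 0 := fun hκ hs =>
    measure_mono_null (compl_subset_compl.2 (Icc_subset_Icc (neg_le_neg hs) hs)) hκ
  have := hfin x
  rw [Measure.ext_of_moments (hmono (hnull x) (le_max_right _ _)) (hmono hnull' (le_max_left _ _))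
    fun k => (hmom x k).trans (hmom' k).symm]
  exact hnull'

end Moments

/-! ### Stieltjes transforms as analytic maps into the Banach space. -/

section Stieltjes

open Filter Topology Asymptotics

theorem im_le_norm_ofReal_sub (z : ℂ) (t : ℝ) : z.im ≤ ‖(t : ℂ) - z‖ := by
  have := Complex.abs_im_le_norm ((t : ℂ) - z)
  rw [Complex.sub_im, Complex.ofReal_im, zero_sub, abs_neg] at this
  exact (le_abs_self _).trans this

theorem ofReal_sub_ne_zero {z : ℂ} (hz : 0 < z.im) (t : ℝ) : (t : ℂ) - z ≠ 0 :=
  norm_pos_iff.1 (hz.trans_le (im_le_norm_ofReal_sub z t))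

theorem norm_one_div_ofReal_sub_le {z : ℂ} (hz : 0 < z.im) (t : ℝ) :
    ‖1 / ((t : ℂ) - z)‖ ≤ 1 / z.im := by
  rw [norm_div, norm_one]
  exact one_div_le_one_div_of_le hz (im_le_norm_ofReal_sub z t)

theorem continuous_one_div_ofReal_sub {z : ℂ} (hz : 0 < z.im) :
    Continuous fun t : ℝ => 1 / ((t : ℂ) - z) :=
  continuous_const.div (by fun_prop) (ofReal_sub_ne_zero hz)

theorem one_div_ofReal_sub_taylor {z w : ℂ} (hz : 0 < z.im) (hw : 0 < w.im) (t : ℝ) :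
    1 / ((t : ℂ) - w) - 1 / ((t : ℂ) - z) - (w - z) * (1 / ((t : ℂ) - z)) ^ 2 =
      (w - z) ^ 2 * (1 / ((t : ℂ) - w) * (1 / ((t : ℂ) - z)) ^ 2) := by
  have h1 := ofReal_sub_ne_zero hz t
  have h2 := ofReal_sub_ne_zero hw t
  field_simp
  ring

variable {X : Type*} [MeasurableSpace X]

/-- A family of probability measures on a fixed compact interval with measurable moments. -/
structure IsMomentFamily (ν : X → Measure ℝ) (ρ : ℝ) : Prop where
  prob : ∀ x, IsProbabilityMeasure (ν x)
  null : ∀ x, ν x (Icc (-ρ) ρ)ᶜ = 0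
  meas : ∀ k : ℕ, Measurable fun x => ∫ t, t ^ k ∂(ν x)

namespace IsMomentFamily

variable {ν : X → Measure ℝ} {ρ : ℝ}

/-- The bounded measurable function `x ↦ ∫ f dνₓ`. -/
noncomputable def integral (h : IsMomentFamily ν ρ) (f : ℝ → ℂ) (hf : Continuous f) (C : ℝ)
    (hC : ∀ t, ‖f t‖ ≤ C) : BMeas X :=
  BMeas.mk (fun x => ∫ t, f t ∂(ν x))
    (by
      have := h.prob
      exact measurable_integral_of_moments_complex (B := 1) h.null (by simp) h.meas hf) C
    fun x => by
      have := h.prob x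
      simpa using norm_integral_le_of_norm_le_const (μ := ν x) (Eventually.of_forall hC)

/-- The function `x ↦ ∫ (t - z)⁻¹ νₓ(dt)`, extended by zero from the upper half-plane. -/
noncomputable def stieltjes (h : IsMomentFamily ν ρ) (z : ℂ) : BMeas X :=
  if hz : 0 < z.im then
    h.integral (fun t => 1 / ((t : ℂ) - z)) (continuous_one_div_ofReal_sub hz) (1 / z.im)
      (norm_one_div_ofReal_sub_le hz)
  else 0

theorem stieltjes_apply (h : IsMomentFamily ν ρ) {z : ℂ} (hz : 0 < z.im) (x : X) :
    h.stieltjes z x = ∫ t : ℝ, 1 / ((t : ℂ) - z) ∂(ν x) := by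
  rw [stieltjes, dif_pos hz]
  rfl

theorem integrable (h : IsMomentFamily ν ρ) {f : ℝ → ℂ} (hf : Continuous f) (x : X) :
    Integrable f (ν x) :=
  have := h.prob x
  hf.continuousOn.integrable_of_measure_compl_eq_zero (h.null x)

/-- The remainder in `one_div_ofReal_sub_taylor` is `(w - z)²` times a kernel bounded uniformly in
`t`. The bound is therefore uniform in `x`, and the derivative exists in the supremum norm. -/
theorem hasDerivAt_stieltjes (h : IsMomentFamily ν ρ) {z : ℂ} (hz : 0 < z.im) :
    ∃ d : BMeas X, HasDerivAt h.stieltjes d z := by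
  have hcz := continuous_one_div_ofReal_sub hz
  have hbd : ∀ t : ℝ, ‖(1 / ((t : ℂ) - z)) ^ 2‖ ≤ (1 / z.im) ^ 2 := fun t => by
    rw [norm_pow]
    exact pow_le_pow_left₀ (norm_nonneg _) (norm_one_div_ofReal_sub_le hz t) 2
  refine ⟨h.integral (fun t => (1 / ((t : ℂ) - z)) ^ 2) (hcz.pow 2) ((1 / z.im) ^ 2) hbd, ?_⟩
  rw [hasDerivAt_iff_isLittleO]
  refine IsBigO.trans_isLittleO ?_ (isLittleO_pow_sub_sub z one_lt_two)
  refine IsBigO.of_bound (1 / (z.im / 2) * (1 / z.im) ^ 2) ?_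
  -- Keeping `Im w > Im z / 2` bounds `1 / (t - w)` independently of `w`.
  have hev : ∀ᶠ w : ℂ in 𝓝 z, z.im / 2 < w.im :=
    Complex.continuous_im.continuousAt.eventually (lt_mem_nhds (half_lt_self hz))
  filter_upwards [hev] with w hw
  have hw0 : 0 < w.im := (half_pos hz).trans hw
  have hcw := continuous_one_div_ofReal_sub hw0
  refine BMeas.norm_le (by positivity) fun x => ?_
  have hprob := h.prob x
  rw [BMeas.sub_apply, BMeas.sub_apply, BMeas.smul_apply, h.stieltjes_apply hw0,
    h.stieltjes_apply hz]
  change ‖_ - _ - (w - z) * ∫ t : ℝ, (1 / ((t : ℂ) - z)) ^ 2 ∂(ν x)‖ ≤ _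
  rw [← integral_const_mul, ← integral_sub (h.integrable hcw x) (h.integrable hcz x),
    ← integral_sub (h.integrable (f := fun t : ℝ => 1 / ((t : ℂ) - w) - 1 / ((t : ℂ) - z))
        (hcw.sub hcz) x)
      (h.integrable (f := fun t : ℝ => (w - z) * (1 / ((t : ℂ) - z)) ^ 2)
        (continuous_const.mul (hcz.pow 2)) x)]
  simp only [one_div_ofReal_sub_taylor hz hw0]
  have := norm_integral_le_of_norm_le_const (μ := ν x)
    (f := fun t : ℝ => (w - z) ^ 2 * (1 / ((t : ℂ) - w) * (1 / ((t : ℂ) - z)) ^ 2))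
    (C := 1 / (z.im / 2) * (1 / z.im) ^ 2 * ‖‖w - z‖ ^ 2‖) (Eventually.of_forall fun t => by
      rw [norm_mul, norm_mul, norm_pow, mul_comm, norm_pow ‖w - z‖, norm_norm]
      gcongr
      · refine (norm_one_div_ofReal_sub_le hw0 t).trans ?_
        gcongr
      · exact hbd t)
  simpa using this

theorem analyticOnNhd_stieltjes (h : IsMomentFamily ν ρ) :
    AnalyticOnNhd ℂ h.stieltjes {z : ℂ | 0 < z.im} := by
  refine DifferentiableOn.analyticOnNhd (fun z hz => ?_)
    (isOpen_lt continuous_const Complex.continuous_im)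
  obtain ⟨d, hd⟩ := h.hasDerivAt_stieltjes hz
  exact hd.differentiableAt.differentiableWithinAt

theorem stieltjes_im_pos (h : IsMomentFamily ν ρ) {z : ℂ} (hz : 0 < z.im) (x : X) :
    0 < (h.stieltjes z x).im := by
  have hprob := h.prob x
  have hc := continuous_one_div_ofReal_sub hz
  have him : ∀ t : ℝ, 0 < (1 / ((t : ℂ) - z)).im := fun t => by
    rw [one_div, Complex.inv_im, Complex.sub_im, Complex.ofReal_im, zero_sub, neg_neg]
    exact div_pos hz (Complex.normSq_pos.2 (ofReal_sub_ne_zero hz t))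
  rw [h.stieltjes_apply hz]
  have h1 : (∫ t : ℝ, 1 / ((t : ℂ) - z) ∂(ν x)).im = ∫ t : ℝ, (1 / ((t : ℂ) - z)).im ∂(ν x) :=
    (integral_im (𝕜 := ℂ) (h.integrable hc x)).symm
  rw [h1, integral_pos_iff_support_of_nonneg (fun t => (him t).le) (h.integrable hc x).im]
  rw [show Function.support (fun t : ℝ => (1 / ((t : ℂ) - z)).im) = univ from
    eq_univ_of_forall fun t => (him t).ne']
  simp

theorem hasSum_stieltjes (h : IsMomentFamily ν ρ) (hρ : 0 ≤ ρ) {z : ℂ} (hz : 0 < z.im)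
    (hzρ : ρ < ‖z‖) (x : X) :
    HasSum (fun k : ℕ => ((∫ t, t ^ k ∂(ν x) : ℝ) : ℂ) * (1 / z) ^ (k + 1))
      (-h.stieltjes z x) := by
  have hprob := h.prob x
  have hz0 : 0 < ‖z‖ := hρ.trans_lt hzρ
  have hr1 : ρ / ‖z‖ < 1 := (div_lt_one hz0).2 hzρ
  have hae : ∀ᵐ t ∂(ν x), t ∈ Icc (-ρ) ρ := h.null x
  have key := hasSum_integral_of_dominated_convergence (μ := ν x)
    (F := fun (k : ℕ) (t : ℝ) => ((t ^ k : ℝ) : ℂ) * (1 / z) ^ (k + 1))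
    (f := fun t => -(1 / ((t : ℂ) - z)))
    (fun k _ => (ρ / ‖z‖) ^ k * (1 / ‖z‖)) (fun k => by fun_prop) (fun k => ?_) ?_ ?_ ?_
  · rw [integral_neg, ← h.stieltjes_apply hz] at key
    rw [show (fun k : ℕ => ((∫ t, t ^ k ∂(ν x) : ℝ) : ℂ) * (1 / z) ^ (k + 1)) =
      fun k : ℕ => ∫ t, ((t ^ k : ℝ) : ℂ) * (1 / z) ^ (k + 1) ∂(ν x) from funext fun k => ?_]
    · exact key
    rw [integral_mul_const]
    congr 1
    exact integral_ofReal.symm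
  · filter_upwards [hae] with t ht
    rw [norm_mul, norm_pow, norm_div, norm_one, Complex.norm_real, Real.norm_eq_abs, abs_pow,
      pow_succ, ← mul_assoc, ← mul_pow]
    have h1 : |t| * (1 / ‖z‖) ≤ ρ / ‖z‖ := by
      rw [mul_one_div]
      exact div_le_div_of_nonneg_right (abs_le.2 ht) hz0.le
    simpa using mul_le_mul_of_nonneg_right (pow_le_pow_left₀ (by positivity) h1 k)
      (one_div_nonneg.2 hz0.le)
  · exact Eventually.of_forall fun t =>
      (summable_geometric_of_lt_one (by positivity) hr1).mul_right _
  · exact integrable_const _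
  · filter_upwards [hae] with t ht
    have ht1 : ‖(t : ℂ) / z‖ < 1 := by
      rw [norm_div, Complex.norm_real, Real.norm_eq_abs]
      exact (div_le_div_of_nonneg_right (abs_le.2 ht) hz0.le).trans_lt hr1
    have hz' : z ≠ 0 := norm_pos_iff.1 hz0
    have ht2 := ofReal_sub_ne_zero hz t
    have ht3 : z - t ≠ 0 := by rw [← neg_sub]; exact neg_ne_zero.2 ht2
    have hgeo := (hasSum_geometric_of_norm_lt_one ht1).mul_right (1 / z)
    rw [show (1 - (t : ℂ) / z)⁻¹ * (1 / z) = -(1 / ((t : ℂ) - z)) by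
      rw [← neg_sub z, show 1 - (t : ℂ) / z = (z - t) / z by field_simp]
      field_simp] at hgeo
    rw [show (fun k : ℕ => ((t ^ k : ℝ) : ℂ) * (1 / z) ^ (k + 1)) =
      fun k : ℕ => ((t : ℂ) / z) ^ k * (1 / z) from funext fun k => ?_]
    · exact hgeo
    rw [Complex.ofReal_pow, pow_succ, ← mul_assoc, ← mul_pow, mul_one_div (t : ℂ)]

end IsMomentFamily

end Stieltjes

/-! ### Existence: the equation near infinity and its continuation. -/

section Solution

open Filter Topology

variable {X : Type*} [MeasurableSpace X] {μ : Measure X} {a : BMeas X} {S : BMeas X →L[ℂ] BMeas X}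

/-- The convolution is a Cauchy product shifted by one power of `1 / z`. Here `G` stands for `-m`
and `H` for `-S m`. -/
theorem qve_of_hasSum {z α : ℂ} (hz : z ≠ 0) {M N : ℕ → ℂ} (h0 : M 0 = 1)
    (h : ∀ n, M (n + 1) = -(α * M n) + ∑ i ∈ Finset.range n, M i * N (n - 1 - i)) {G H : ℂ}
    (hG : HasSum (fun k => M k * (1 / z) ^ (k + 1)) G)
    (hGn : Summable fun k => ‖M k * (1 / z) ^ (k + 1)‖)
    (hH : HasSum (fun k => N k * (1 / z) ^ (k + 1)) H)
    (hHn : Summable fun k => ‖N k * (1 / z) ^ (k + 1)‖) : z * G = 1 - α * G + G * H := by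
  have hc := hasSum_sum_range_mul_of_summable_norm hGn hHn
  rw [hG.tsum_eq, hH.tsum_eq] at hc
  have hc' : HasSum (fun k => ∑ i ∈ Finset.range k,
      M i * (1 / z) ^ (i + 1) * (N (k - 1 - i) * (1 / z) ^ (k - 1 - i + 1))) (G * H) := by
    rw [hasSum_nat_add_iff' 1 |>.symm]
    simpa using hc
  have h1 : HasSum (fun k => z * (M (k + 1) * (1 / z) ^ (k + 1 + 1))) (z * G - 1) := by
    have := (hasSum_nat_add_iff' 1).2 (hG.mul_left z)
    simpa [h0, hz] using this
  have h3 : (fun k => z * (M (k + 1) * (1 / z) ^ (k + 1 + 1))) = fun k =>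
      -α * (M k * (1 / z) ^ (k + 1)) + ∑ i ∈ Finset.range k,
      M i * (1 / z) ^ (i + 1) * (N (k - 1 - i) * (1 / z) ^ (k - 1 - i + 1)) := by
    ext k
    rw [h, pow_succ _ (k + 1)]
    have e : ∀ c d : ℂ, z * (c * (d * (1 / z))) = c * d := fun c d => by field_simp
    rw [e, add_mul, Finset.sum_mul]
    congr 1
    · ring
    · refine Finset.sum_congr rfl fun i hi => ?_
      rw [Finset.mem_range] at hi
      rw [show k + 1 = (i + 1) + (k - 1 - i + 1) by omega, pow_add]
      ring
  rw [h3] at h1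
  have := h1.unique ((hG.mul_left (-α)).add hc')
  linear_combination this

theorem qve_of_large_norm (hS : IsSymmPosPreserving μ S) (ha : ∀ x, (a x).im = 0)
    {ν : X → Measure ℝ} {ρ : ℝ} (h : IsMomentFamily ν ρ)
    (hρ : ‖a‖ + 2 * Real.sqrt ‖S‖ < ρ)
    (hν : ∀ x k, ∫ t, t ^ k ∂(ν x) = (qveMoment a S k x).re) {z : ℂ} (hz : 0 < z.im)
    (hzρ : ρ < ‖z‖) (x : X) :
    h.stieltjes z x * (z + a x + S (h.stieltjes z) x) = -1 := by
  have hρ0 : 0 < ρ := hρ.trans_le' (by positivity)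
  have hz0 : 0 < ‖z‖ := hρ0.trans hzρ
  obtain ⟨C, hC⟩ := exists_norm_qveMoment_le hρ
  -- Summing in norm, not just pointwise, lets the bounded operator `S` be applied termwise.
  have hsum : Summable fun k => ‖(1 / z) ^ (k + 1) • qveMoment a S k‖ := by
    refine Summable.of_nonneg_of_le (fun _ => norm_nonneg _) (fun k => ?_)
      ((summable_geometric_of_lt_one (by positivity) ((div_lt_one hz0).2 hzρ)).mul_left
        (C * (1 / ‖z‖)))
    rw [norm_smul, norm_pow, norm_div, norm_one]
    refine (mul_le_mul_of_nonneg_left (hC k) (by positivity)).trans (le_of_eq ?_)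
    rw [pow_succ, div_pow, div_pow, one_pow]
    ring
  obtain ⟨g, hg⟩ := hsum.of_norm
  have hgx : ∀ y, HasSum (fun k => qveMoment a S k y * (1 / z) ^ (k + 1)) (g y) := fun y => by
    have := (BMeas.eval y).hasSum hg
    simpa only [BMeas.eval_apply, BMeas.smul_apply, mul_comm] using this
  have hgs : g = -h.stieltjes z := BMeas.ext fun y => by
    refine (hgx y).unique ?_
    rw [BMeas.neg_apply, show (fun k => qveMoment a S k y * (1 / z) ^ (k + 1)) =
      fun k : ℕ => ((∫ t, t ^ k ∂(ν y) : ℝ) : ℂ) * (1 / z) ^ (k + 1) from funext fun k => ?_]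
    · exact h.hasSum_stieltjes hρ0.le hz hzρ y
    · rw [hν]
      congr 1
      exact Complex.ext rfl (by rw [qveMoment_im ha hS, Complex.ofReal_im])
  have hev : ∀ T : BMeas X →L[ℂ] ℂ, Summable fun k => ‖T ((1 / z) ^ (k + 1) • qveMoment a S k)‖ :=
    fun T => Summable.of_nonneg_of_le (fun _ => norm_nonneg _) (fun k => T.le_opNorm _)
      (hsum.mul_left _)
  have key := qve_of_hasSum (norm_pos_iff.1 hz0) (M := fun k => qveMoment a S k x)
    (N := fun k => S (qveMoment a S k) x) (qveMoment_zero_apply a S x)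
    (fun n => qveMoment_succ_apply a S n x) (hgx x) ?_ (H := S g x) ?_ ?_
  · rw [hgs, S.map_neg, BMeas.neg_apply, BMeas.neg_apply] at key
    linear_combination -key
  · have := hev (BMeas.eval x)
    simpa only [BMeas.eval_apply, BMeas.smul_apply, mul_comm] using this
  · have := ((BMeas.eval x).comp S).hasSum hg
    simpa only [ContinuousLinearMap.comp_apply, S.map_smul, BMeas.eval_apply, BMeas.smul_apply,
      mul_comm] using this
  · have := hev ((BMeas.eval x).comp S)
    simpa only [ContinuousLinearMap.comp_apply, S.map_smul, BMeas.eval_apply, BMeas.smul_apply,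
      mul_comm] using this

theorem solvesQVE_stieltjes (hS : IsSymmPosPreserving μ S) (ha : ∀ x, (a x).im = 0)
    {ν : X → Measure ℝ} {ρ : ℝ} (h : IsMomentFamily ν ρ)
    (hρ : ‖a‖ + 2 * Real.sqrt ‖S‖ < ρ)
    (hν : ∀ x k, ∫ t, t ^ k ∂(ν x) = (qveMoment a S k x).re) {z : ℂ} (hz : 0 < z.im) :
    SolvesQVE a S z (h.stieltjes z) := by
  refine ⟨fun x => h.stieltjes_im_pos hz x, fun x => ?_⟩
  have hρ0 : 0 < ρ := hρ.trans_le' (by positivity)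
  have han : AnalyticOnNhd ℂ
      (fun w => h.stieltjes w x * (w + a x + S (h.stieltjes w) x)) {w : ℂ | 0 < w.im} := by
    have h1 := (BMeas.eval x).comp_analyticOnNhd h.analyticOnNhd_stieltjes
    have h2 := ((BMeas.eval x).comp S).comp_analyticOnNhd h.analyticOnNhd_stieltjes
    exact h1.mul ((analyticOnNhd_id.add analyticOnNhd_const).add h2)
  -- Near the base point `(ρ + 1) i` one has `Im w > ρ`, so the series converges there. The
  -- multiplied-out equation avoids dividing before `m ≠ 0` is invoked.
  have heq := han.eqOn_of_preconnected_of_eventuallyEq (g := fun _ => -1) analyticOnNhd_const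
    (convex_halfSpace_im_gt 0).isPreconnected (z₀ := ((ρ + 1 : ℝ) : ℂ) * Complex.I)
    (by simp; positivity) (by
      have h1 : ∀ᶠ w : ℂ in 𝓝 (((ρ + 1 : ℝ) : ℂ) * Complex.I), ρ < w.im :=
        Complex.continuous_im.continuousAt.eventually (lt_mem_nhds (by simp))
      filter_upwards [h1] with w hw
      exact qve_of_large_norm hS ha h hρ hν (hρ0.trans hw)
        (hw.trans_le ((le_abs_self _).trans (Complex.abs_im_le_norm w))) x)
  have hm : h.stieltjes z x ≠ 0 := fun h0 => by
    have := h.stieltjes_im_pos hz x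
    rw [h0] at this
    exact lt_irrefl _ this
  have := heq hz
  simp only at this
  rw [← neg_div, div_eq_iff hm, ← this, mul_comm]

end Solution

/-! ### Uniqueness and the L² bound. -/

namespace SolvesQVE

open Filter Topology

variable {X : Type*} [MeasurableSpace X] {μ : Measure X} {a : BMeas X} {S : BMeas X →L[ℂ] BMeas X}
  {z : ℂ} {u w : BMeas X}

theorem ne_zero (hu : SolvesQVE a S z u) (x : X) : u x ≠ 0 := fun h0 => by
  have := hu.1 x
  rw [h0] at this
  exact lt_irrefl _ this

theorem mul_eq (hu : SolvesQVE a S z u) (x : X) : u x * (z + a x + S u x) = -1 := by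
  rw [← hu.2 x]
  field_simp [hu.ne_zero x]

theorem im_eq (ha : ∀ x, (a x).im = 0) (hS : IsSymmPosPreserving μ S) (hu : SolvesQVE a S z u)
    (x : X) : (u x).im = ‖u x‖ ^ 2 * (z.im + (S u.imPart x).re) := by
  have h := congrArg Complex.im (hu.2 x)
  rw [Complex.add_im, Complex.add_im, ha, add_zero, hS.im_apply, Complex.neg_im, one_div,
    Complex.inv_im, neg_div, neg_neg, Complex.normSq_eq_norm_sq] at h
  rw [← h]
  have := norm_ne_zero_iff.2 (hu.ne_zero x)
  field_simp

theorem re_imPart_nonneg (hS : IsSymmPosPreserving μ S) (hu : SolvesQVE a S z u) (x : X) :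
    0 ≤ (S u.imPart x).re :=
  (hS.nonneg u.imPart (fun y => ⟨Complex.ofReal_im _, (hu.1 y).le⟩) x).2

theorem re_imPart_le (hS : IsSymmPosPreserving μ S) (x : X) :
    (S u.imPart x).re ≤ ‖S‖ * ‖u‖ := by
  rw [← hS.im_apply]
  exact (Complex.im_le_norm _).trans ((BMeas.norm_apply_le _ x).trans (S.le_opNorm u))

theorem exists_norm_ge (hu : SolvesQVE a S z u) : ∃ c > 0, ∀ x, c ≤ ‖u x‖ := by
  refine ⟨(‖z‖ + ‖a‖ + ‖S‖ * ‖u‖ + 1)⁻¹, by positivity, fun x => ?_⟩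
  have h := congrArg norm (hu.mul_eq x)
  rw [norm_mul, norm_neg, norm_one] at h
  have h1 : ‖z + a x + S u x‖ ≤ ‖z‖ + ‖a‖ + ‖S‖ * ‖u‖ + 1 := by
    refine (norm_add₃_le).trans ?_
    have h2 := (BMeas.norm_apply_le _ x).trans (S.le_opNorm u)
    have h3 := a.norm_apply_le x
    linarith
  rw [inv_le_iff_one_le_mul₀ (by positivity)]
  exact h.ge.trans (mul_le_mul_of_nonneg_left h1 (norm_nonneg _))

theorem sub_eq (hu : SolvesQVE a S z u) (hw : SolvesQVE a S z w) (x : X) :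
    u x - w x = u x * w x * S (u - w) x := by
  rw [S.map_sub, BMeas.sub_apply]
  linear_combination -w x * hu.mul_eq x + u x * hw.mul_eq x

theorem two_mul_le_add_of_pos {t : ℝ} (ht : 0 < t) (α β : ℝ) :
    2 * (α * β) ≤ t * α ^ 2 + t⁻¹ * β ^ 2 := by
  have h : t * α ^ 2 + t⁻¹ * β ^ 2 - 2 * (α * β) = t⁻¹ * (t * α - β) ^ 2 := by
    field_simp
    ring
  have : 0 ≤ t⁻¹ * (t * α - β) ^ 2 := by positivity
  linarith

theorem re_apply_comb (S : BMeas X →L[ℂ] BMeas X) (p q : BMeas X) (c d : ℝ) (x : X) :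
    (S ((c : ℂ) • p + (d : ℂ) • q) x).re = c * (S p x).re + d * (S q x).re := by
  rw [S.map_add, S.map_smul, S.map_smul, BMeas.add_apply, BMeas.smul_apply, BMeas.smul_apply,
    Complex.add_re, Complex.re_ofReal_mul, Complex.re_ofReal_mul]

/-- The hyperbolic contraction estimate: `|u - w| / √(Im u Im w)` is decreased by a fixed factor. -/
theorem norm_sub_le_contraction (ha : ∀ x, (a x).im = 0) (hS : IsSymmPosPreserving μ S)
    (hz : 0 < z.im) (hu : SolvesQVE a S z u) (hw : SolvesQVE a S z w) {r s : X → ℝ}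
    (hr : ∀ x, r x = Real.sqrt (z.im + (S u.imPart x).re))
    (hs : ∀ x, s x = Real.sqrt (z.im + (S w.imPart x).re)) {D K : ℝ} (hD : 0 < D)
    (hDrs : ∀ x, r x * s x ≤ D) (hK : 0 ≤ K)
    (h : ∀ x, ‖u x - w x‖ ≤ K * (‖u x‖ * r x * (‖w x‖ * s x))) (x : X) :
    ‖u x - w x‖ ≤ K * (1 - z.im / D) * (‖u x‖ * r x * (‖w x‖ * s x)) := by
  have hP : ∀ y, 0 < z.im + (S u.imPart y).re := fun y => by
    linarith [hu.re_imPart_nonneg hS y]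
  have hQ : ∀ y, 0 < z.im + (S w.imPart y).re := fun y => by
    linarith [hw.re_imPart_nonneg hS y]
  have hr0 : ∀ y, 0 < r y := fun y => by rw [hr]; exact Real.sqrt_pos.2 (hP y)
  have hs0 : ∀ y, 0 < s y := fun y => by rw [hs]; exact Real.sqrt_pos.2 (hQ y)
  have hr2 : ∀ y, r y ^ 2 = z.im + (S u.imPart y).re := fun y => by
    rw [hr]; exact Real.sq_sqrt (hP y).le
  have hs2 : ∀ y, s y ^ 2 = z.im + (S w.imPart y).re := fun y => by
    rw [hs]; exact Real.sq_sqrt (hQ y).le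
  -- This weight balances the arithmetic–geometric inequality at `x`: `t r² = t⁻¹ s² = r s`. Since
  -- `(‖u‖ r)² = Im u` and `(‖w‖ s)² = Im w` pointwise, the hypothesis dominates `u - w` by a
  -- combination of `Im u` and `Im w`, to which `S` is monotone.
  set t := s x / r x with ht
  have ht0 : 0 < t := div_pos (hs0 x) (hr0 x)
  have h1 := hS.norm_apply_le (u := u - w)
    (p := ((K / 2 * t : ℝ) : ℂ) • u.imPart + ((K / 2 * t⁻¹ : ℝ) : ℂ) • w.imPart)
    (fun y => by
      rw [BMeas.add_apply, BMeas.smul_apply, BMeas.smul_apply, Complex.add_im,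
        Complex.im_ofReal_mul, Complex.im_ofReal_mul, BMeas.imPart_apply, BMeas.imPart_apply,
        Complex.ofReal_im, Complex.ofReal_im, mul_zero, mul_zero, add_zero])
    (fun y => by
      rw [BMeas.add_apply, BMeas.smul_apply, BMeas.smul_apply, Complex.add_re,
        Complex.re_ofReal_mul, Complex.re_ofReal_mul, BMeas.imPart_apply, BMeas.imPart_apply,
        Complex.ofReal_re, Complex.ofReal_re, hu.im_eq ha hS, hw.im_eq ha hS, ← hr2, ← hs2,
        ← mul_pow, ← mul_pow, BMeas.sub_apply]
      have h2 := mul_le_mul_of_nonneg_left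
        (two_mul_le_add_of_pos ht0 (‖u y‖ * r y) (‖w y‖ * s y)) hK
      linarith [h y])
    x
  rw [re_apply_comb] at h1
  have hA : (S u.imPart x).re = r x ^ 2 - z.im := by rw [hr2]; ring
  have hB : (S w.imPart x).re = s x ^ 2 - z.im := by rw [hs2]; ring
  rw [hA, hB] at h1
  have h3 : K / 2 * t * (r x ^ 2 - z.im) + K / 2 * t⁻¹ * (s x ^ 2 - z.im) =
      K * (r x * s x) - K * z.im / 2 * (t + t⁻¹) := by
    have := (hr0 x).ne'
    have := (hs0 x).ne'
    rw [ht]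
    field_simp
    ring
  -- The gain: `Im z` is subtracted with weight `(t + t⁻¹) / 2 ≥ 1`, and `r s ≤ D` makes this a
  -- fixed proportion of `r s`.
  have h4 : 2 ≤ t + t⁻¹ := by
    have := two_mul_le_add_of_pos ht0 1 1
    linarith
  have h5 : z.im / D * (r x * s x) ≤ z.im := by
    rw [div_mul_eq_mul_div, div_le_iff₀ hD]
    exact mul_le_mul_of_nonneg_left (hDrs x) hz.le
  have h6 : ‖S (u - w) x‖ ≤ K * (1 - z.im / D) * (r x * s x) := by
    refine h1.trans ?_
    rw [h3]
    have h7 : K * z.im / 2 * 2 ≤ K * z.im / 2 * (t + t⁻¹) :=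
      mul_le_mul_of_nonneg_left h4 (by positivity)
    have h8 := mul_le_mul_of_nonneg_left h5 hK
    linarith
  rw [hu.sub_eq hw, norm_mul, norm_mul]
  refine (mul_le_mul_of_nonneg_left h6 (by positivity)).trans (le_of_eq ?_)
  ring

theorem unique (ha : ∀ x, (a x).im = 0) (hS : IsSymmPosPreserving μ S) (hz : 0 < z.im)
    (hu : SolvesQVE a S z u) (hw : SolvesQVE a S z w) : u = w := by
  set r : X → ℝ := fun x => Real.sqrt (z.im + (S u.imPart x).re)
  set s : X → ℝ := fun x => Real.sqrt (z.im + (S w.imPart x).re)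
  have hr0 : ∀ x, Real.sqrt z.im ≤ r x := fun x =>
    Real.sqrt_le_sqrt (by linarith [hu.re_imPart_nonneg hS x])
  have hs0 : ∀ x, Real.sqrt z.im ≤ s x := fun x =>
    Real.sqrt_le_sqrt (by linarith [hw.re_imPart_nonneg hS x])
  have hη : 0 < Real.sqrt z.im := Real.sqrt_pos.2 hz
  set D := Real.sqrt (z.im + ‖S‖ * ‖u‖) * Real.sqrt (z.im + ‖S‖ * ‖w‖) with hDdef
  have hDη : z.im ≤ D := by
    rw [← Real.mul_self_sqrt hz.le, hDdef]
    refine mul_le_mul (Real.sqrt_le_sqrt ?_) (Real.sqrt_le_sqrt ?_) hη.le (by positivity)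
    · linarith [mul_nonneg (norm_nonneg S) (norm_nonneg u)]
    · linarith [mul_nonneg (norm_nonneg S) (norm_nonneg w)]
  have hD : 0 < D := hz.trans_le hDη
  have hDrs : ∀ x, r x * s x ≤ D := fun x =>
    mul_le_mul (Real.sqrt_le_sqrt (by linarith [re_imPart_le (u := u) hS x]))
      (Real.sqrt_le_sqrt (by linarith [re_imPart_le (u := w) hS x]))
      (Real.sqrt_nonneg _) (Real.sqrt_nonneg _)
  obtain ⟨c, hc, hcu⟩ := hu.exists_norm_ge
  obtain ⟨d, hd, hdw⟩ := hw.exists_norm_ge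
  -- A positive lower bound for `√(Im u Im w)`, which makes the ratio finite at the start of the
  -- iteration.
  set κ := c * Real.sqrt z.im * (d * Real.sqrt z.im) with hκ
  have hκ0 : 0 < κ := by positivity
  have hθ0 : 0 ≤ 1 - z.im / D := sub_nonneg.2 ((div_le_one hD).2 hDη)
  have hθ1 : 1 - z.im / D < 1 := sub_lt_self _ (div_pos hz hD)
  have key : ∀ (n : ℕ) x, ‖u x - w x‖ ≤
      ‖u - w‖ / κ * (1 - z.im / D) ^ n * (‖u x‖ * r x * (‖w x‖ * s x)) := fun n => by
    induction n with
    | zero =>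
      intro x
      have h1 : κ ≤ ‖u x‖ * r x * (‖w x‖ * s x) :=
        mul_le_mul (mul_le_mul (hcu x) (hr0 x) hη.le (norm_nonneg _))
          (mul_le_mul (hdw x) (hs0 x) hη.le (norm_nonneg _)) (by positivity)
          (mul_nonneg (norm_nonneg _) (hη.le.trans (hr0 x)))
      rw [pow_zero, mul_one]
      refine ((u - w).norm_apply_le x).trans ?_
      rw [div_mul_eq_mul_div, le_div_iff₀ hκ0]
      exact mul_le_mul_of_nonneg_left h1 (norm_nonneg _)
    | succ n ih =>
      intro x
      rw [pow_succ, ← mul_assoc (‖u - w‖ / κ)]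
      exact norm_sub_le_contraction ha hS hz hu hw (fun _ => rfl) (fun _ => rfl) hD hDrs
        (mul_nonneg (by positivity) (pow_nonneg hθ0 n)) ih x
  refine BMeas.ext fun x => ?_
  have hlim : Tendsto (fun n : ℕ => ‖u - w‖ / κ * (1 - z.im / D) ^ n *
      (‖u x‖ * r x * (‖w x‖ * s x))) atTop (𝓝 0) := by
    simpa using ((tendsto_pow_atTop_nhds_zero_of_lt_one hθ0 hθ1).const_mul
      (‖u - w‖ / κ)).mul_const (‖u x‖ * r x * (‖w x‖ * s x))
  exact sub_eq_zero.1 (norm_le_zero_iff.1 (ge_of_tendsto' hlim fun n => key n x))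

section L2

variable [IsProbabilityMeasure μ]

theorem _root_.BMeas.integrable_of_bound {f : X → ℝ} (hf : Measurable f) {C : ℝ}
    (hC : ∀ x, ‖f x‖ ≤ C) : Integrable f μ :=
  Integrable.of_bound hf.aestronglyMeasurable C (Filter.Eventually.of_forall hC)

/-- Put `P = Im z + S Im u` and `g = 1 / P`, so `|u|² = g Im u`. Cauchy–Schwarz for the positive
functional `v ↦ (S v)ₓ` gives `|S u|² ≤ (S Im u)(S g) ≤ P (S g)`, hence `|u S u|² ≤ Im u (S g)`. By
symmetry the integral of the latter is `∫ (S Im u) / P ≤ 1`. -/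
theorem integral_norm_mul_sq_le (ha : ∀ x, (a x).im = 0) (hS : IsSymmPosPreserving μ S)
    (hz : 0 < z.im) (hu : SolvesQVE a S z u) :
    ∫ x, ‖u x * S u x‖ ^ 2 ∂μ ≤ 1 := by
  have hA := hu.re_imPart_nonneg hS
  have hP : ∀ x, 0 < z.im + (S u.imPart x).re := fun x => by linarith [hA x]
  have hmS : ∀ v : BMeas X, Measurable fun x => (v x).re := fun v =>
    Complex.measurable_re.comp v.measurable
  let g : BMeas X := BMeas.ofReal (fun x => (z.im + (S u.imPart x).re)⁻¹)
    ((measurable_const.add (hmS _)).inv) z.im⁻¹ fun x => by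
      rw [abs_of_pos (inv_pos.2 (hP x))]
      exact inv_anti₀ hz (by linarith [hA x])
  have hg : ∀ x, g x = (((z.im + (S u.imPart x).re)⁻¹ : ℝ) : ℂ) := fun x => rfl
  have hgim : ∀ x, (g x).im = 0 := fun x => Complex.ofReal_im _
  have hG : ∀ x, 0 ≤ (S g x).re := fun x =>
    (hS.nonneg g (fun y => ⟨hgim y, (inv_pos.2 (hP y)).le⟩) x).2
  have hpt : ∀ x, ‖u x * S u x‖ ^ 2 ≤ (u x).im * (S g x).re := fun x => by
    rw [norm_mul, mul_pow, hu.im_eq ha hS, mul_assoc]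
    refine mul_le_mul_of_nonneg_left ?_ (sq_nonneg _)
    rcases (norm_nonneg (S u x)).eq_or_lt with h0 | h0
    · rw [← h0]
      have := mul_nonneg (hP x).le (hG x)
      simpa using this
    -- With this weight the `Im u` term is at most `‖S u x‖ / 2` and is absorbed on the left.
    set t := ‖S u x‖ / (z.im + (S u.imPart x).re) with ht
    have ht0 : 0 < t := div_pos h0 (hP x)
    have h1 := hS.norm_apply_le (u := u)
      (p := ((1 / 2 * t : ℝ) : ℂ) • u.imPart + ((1 / 2 * t⁻¹ : ℝ) : ℂ) • g)
      (fun y => by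
        rw [BMeas.add_apply, BMeas.smul_apply, BMeas.smul_apply, Complex.add_im,
          Complex.im_ofReal_mul, Complex.im_ofReal_mul, BMeas.imPart_apply, hgim,
          Complex.ofReal_im, mul_zero, mul_zero, add_zero])
      (fun y => by
        rw [BMeas.add_apply, BMeas.smul_apply, BMeas.smul_apply, Complex.add_re,
          Complex.re_ofReal_mul, Complex.re_ofReal_mul, BMeas.imPart_apply, hg,
          Complex.ofReal_re, Complex.ofReal_re, hu.im_eq ha hS]
        have hr := Real.sqrt_pos.2 (hP y)
        have h2 := two_mul_le_add_of_pos ht0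
          (‖u y‖ * Real.sqrt (z.im + (S u.imPart y).re))
          (Real.sqrt (z.im + (S u.imPart y).re))⁻¹
        rw [mul_assoc, mul_inv_cancel₀ hr.ne', mul_one, mul_pow, inv_pow,
          Real.sq_sqrt (hP y).le] at h2
        linarith)
      x
    rw [re_apply_comb] at h1
    have h3 : t * (S u.imPart x).re ≤ ‖S u x‖ := by
      rw [ht, div_mul_eq_mul_div, div_le_iff₀ (hP x)]
      exact mul_le_mul_of_nonneg_left (by linarith) h0.le
    have h4 : ‖S u x‖ ≤ t⁻¹ * (S g x).re := by linarith
    rw [ht, inv_div, div_mul_eq_mul_div, le_div_iff₀ h0] at h4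
    linarith [sq ‖S u x‖]
  have hsymm : ∫ x, (u x).im * (S g x).re ∂μ =
      ∫ x, (S u.imPart x).re * (z.im + (S u.imPart x).re)⁻¹ ∂μ := by
    have h1 := hS.symm u.imPart g
    have e1 : ∀ x, conj (u.imPart x) * S g x = (((u x).im * (S g x).re : ℝ) : ℂ) := fun x => by
      rw [BMeas.imPart_apply, Complex.conj_ofReal, Complex.ofReal_mul]
      congr 1
      exact Complex.ext rfl (hS.im_eq_zero hgim x)
    have e2 : ∀ x, conj (S u.imPart x) * g x =
        (((S u.imPart x).re * (z.im + (S u.imPart x).re)⁻¹ : ℝ) : ℂ) := fun x => by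
      rw [hg, Complex.ofReal_mul]
      congr 1
      refine Complex.ext rfl ?_
      rw [Complex.conj_im, hS.im_eq_zero (fun y => Complex.ofReal_im _), neg_zero,
        Complex.ofReal_im]
    simp only [e1, e2] at h1
    rw [integral_complex_ofReal, integral_complex_ofReal] at h1
    exact Complex.ofReal_injective h1
  have hle1 : ∀ x, (S u.imPart x).re * (z.im + (S u.imPart x).re)⁻¹ ≤ 1 := fun x => by
    rw [← div_eq_mul_inv, div_le_one (hP x)]
    linarith
  calc ∫ x, ‖u x * S u x‖ ^ 2 ∂μ ≤ ∫ x, (u x).im * (S g x).re ∂μ := by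
        refine integral_mono
          (BMeas.integrable_of_bound (((u.mul (S u)).measurable.norm).pow_const 2)
            (C := ‖u.mul (S u)‖ ^ 2) fun x => ?_)
          (BMeas.integrable_of_bound ((Complex.measurable_im.comp u.measurable).mul (hmS _))
            (C := ‖u‖ * ‖S g‖) fun x => ?_) hpt
        · rw [norm_pow, norm_norm]
          exact pow_le_pow_left₀ (norm_nonneg _) ((u.mul (S u)).norm_apply_le x) 2
        · rw [norm_mul]
          exact mul_le_mul ((Complex.abs_im_le_norm _).trans (u.norm_apply_le x))
            ((Complex.abs_re_le_norm _).trans ((S g).norm_apply_le x)) (norm_nonneg _)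
            (norm_nonneg _)
    _ = ∫ x, (S u.imPart x).re * (z.im + (S u.imPart x).re)⁻¹ ∂μ := hsymm
    _ ≤ ∫ _, 1 ∂μ := by
        refine integral_mono (BMeas.integrable_of_bound
          ((hmS _).mul (measurable_const.add (hmS _)).inv) (C := 1) fun x => ?_)
          (integrable_const _) hle1
        rw [Real.norm_eq_abs, abs_of_nonneg (mul_nonneg (hA x) (inv_pos.2 (hP x)).le)]
        exact hle1 x
    _ = 1 := by simp

theorem _root_.BMeas.memLp (v : BMeas X) (p : ℝ≥0∞) : MemLp (fun x => v x) p μ :=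
  MemLp.of_bound v.measurable.aestronglyMeasurable ‖v‖ (Filter.Eventually.of_forall v.norm_apply_le)

theorem eLpNorm_two_le (hS : IsSymmPosPreserving μ S) (hz : 0 < z.im)
    (hu : SolvesQVE 0 S z u) : eLpNorm (fun x => u x) 2 μ ≤ ENNReal.ofReal (2 / ‖z‖) := by
  have hz0 : 0 < ‖z‖ := hz.trans_le ((le_abs_self _).trans (Complex.abs_im_le_norm z))
  have hb := hu.integral_norm_mul_sq_le (fun x => Complex.zero_im) hS hz
  have hint : ∀ v : BMeas X, Integrable (fun x => ‖v x‖ ^ 2) μ := fun v =>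
    BMeas.integrable_of_bound (v.measurable.norm.pow_const 2) (C := ‖v‖ ^ 2) fun x => by
      rw [norm_pow, norm_norm]
      exact pow_le_pow_left₀ (norm_nonneg _) (v.norm_apply_le x) 2
  -- From `z u = -1 - u S u` and `(1 + b)² ≤ 2 + 2 b²`; integration then gives the constant `4 =
  -- 2²`.
  have hpt : ∀ x, ‖z‖ ^ 2 * ‖u x‖ ^ 2 ≤ 2 + 2 * ‖u x * S u x‖ ^ 2 := fun x => by
    have h1 : z * u x = -1 - u x * S u x := by
      have := hu.mul_eq x
      rw [BMeas.zero_apply] at this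
      linear_combination this
    have h2 : ‖z‖ * ‖u x‖ ≤ 1 + ‖u x * S u x‖ := by
      rw [← norm_mul, h1]
      exact (norm_sub_le _ _).trans (by simp)
    rw [← mul_pow]
    refine (pow_le_pow_left₀ (by positivity) h2 2).trans ?_
    nlinarith [sq_nonneg (1 - ‖u x * S u x‖)]
  have h4 : ‖z‖ ^ 2 * ∫ x, ‖u x‖ ^ 2 ∂μ ≤ 4 := by
    rw [← integral_const_mul]
    have hi : Integrable (fun x => 2 * ‖u x * S u x‖ ^ 2) μ := (hint (u.mul (S u))).const_mul 2
    refine (integral_mono ((hint u).const_mul _) ((integrable_const 2).add hi) hpt).trans ?_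
    have h5 : ∫ x, (2 + 2 * ‖u x * S u x‖ ^ 2) ∂μ = 2 + 2 * ∫ x, ‖u x * S u x‖ ^ 2 ∂μ := by
      rw [integral_add (integrable_const 2) hi, integral_const_mul]
      simp
    refine (le_of_eq h5).trans ?_
    linarith
  rw [(u.memLp 2).eLpNorm_eq_integral_rpow_norm two_ne_zero ENNReal.ofNat_ne_top]
  refine ENNReal.ofReal_le_ofReal ?_
  simp only [ENNReal.toReal_ofNat, Real.rpow_two]
  rw [← one_div, ← Real.sqrt_eq_rpow]
  refine Real.sqrt_le_iff.2 ⟨by positivity, ?_⟩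
  rw [div_pow, le_div_iff₀ (by positivity), mul_comm]
  linarith

end L2

end SolvesQVE

/-! ### Symmetry of the measures and assembly of the theorem. -/

theorem MeasureTheory.Measure.neg_eq_of_odd_moments_eq_zero {ν : Measure ℝ} [IsFiniteMeasure ν]
    {ρ : ℝ} (hν : ν (Icc (-ρ) ρ)ᶜ = 0) (hodd : ∀ k : ℕ, ∫ t, t ^ (2 * k + 1) ∂ν = 0) {A : Set ℝ}
    (hA : MeasurableSet A) : ν (-A) = ν A := by
  have h : ν.map Neg.neg = ν := by
    refine Measure.ext_of_moments ?_ hν fun k => ?_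
    · rw [Measure.map_apply measurable_neg measurableSet_Icc.compl, preimage_compl]
      rwa [show Neg.neg ⁻¹' Icc (-ρ) ρ = Icc (-ρ) ρ by simp]
    · rw [integral_map (by fun_prop) (by fun_prop)]
      rcases Nat.even_or_odd' k with ⟨j, rfl | rfl⟩
      · simp only [(even_two_mul j).neg_pow]
      · simp only [(odd_two_mul_add_one j).neg_pow, integral_neg, hodd, neg_zero]
  conv_rhs => rw [← h]
  rw [Measure.map_apply measurable_neg hA]
  rfl

theorem mainTheorem4 {X : Type*} [MeasurableSpace X] (μ : Measure X) [IsProbabilityMeasure μ]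
    (a : BMeas X) (ha : ∀ x, (a x).im = 0)
    (S : BMeas X →L[ℂ] BMeas X) (hS : IsSymmPosPreserving μ S) :
    ∃ m : ℂ → BMeas X,
      (∀ z : ℂ, 0 < z.im → SolvesQVE a S z (m z) ∧ ∀ u : BMeas X, SolvesQVE a S z u → u = m z) ∧
      AnalyticOnNhd ℂ m {z : ℂ | 0 < z.im} ∧
      ∃ v : X → FiniteMeasure ℝ,
        (∀ x, (v x : Measure ℝ).support ⊆
          Icc (-(‖a‖ + 2 * Real.sqrt ‖S‖)) (‖a‖ + 2 * Real.sqrt ‖S‖)) ∧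
        (∀ x, (v x : Measure ℝ) univ = ENNReal.ofReal Real.pi) ∧
        (∀ x, ∀ z : ℂ, 0 < z.im →
          m z x = 1 / (Real.pi : ℂ) * ∫ τ : ℝ, 1 / ((τ : ℂ) - z) ∂(v x : Measure ℝ)) ∧
        Measurable[_, borel (FiniteMeasure ℝ)] v ∧
        (a = 0 →
          (∀ z : ℂ, 0 < z.im → MemLp (fun x => m z x) 2 μ ∧
            eLpNorm (fun x => m z x) 2 μ ≤ ENNReal.ofReal (2 / ‖z‖)) ∧
          (∀ x, ∀ A : Set ℝ, MeasurableSet A →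
            (v x : Measure ℝ) (-A) = (v x : Measure ℝ) A)) := by

  set R := ‖a‖ + 2 * Real.sqrt ‖S‖
  obtain ⟨ν, hν⟩ := exists_qveMeasure ha hS
  have hfin : ∀ x, IsFiniteMeasure (ν x) := fun x => (hν x).1
  have hnull : ∀ x ρ, R < ρ → ν x (Icc (-ρ) ρ)ᶜ = 0 := fun x => (hν x).2.1
  have hmom : ∀ x k, ∫ t, t ^ k ∂(ν x) = (qveMoment a S k x).re := fun x => (hν x).2.2
  have hlt : R < R + 1 := lt_add_one _
  have hreal : ∀ x, (ν x).real univ = 1 := fun x => by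
    have := hmom x 0
    rw [qveMoment_zero_apply, Complex.one_re] at this
    simpa using this
  have huniv : ∀ x, ν x univ = 1 := fun x => by
    have := hreal x
    rwa [measureReal_def, ENNReal.toReal_eq_one_iff] at this
  have hfam : IsMomentFamily ν (R + 1) :=
    { prob := fun x => ⟨huniv x⟩
      null := fun x => hnull x _ hlt
      meas := fun k => by
        simp only [hmom]
        exact Complex.measurable_re.comp (qveMoment a S k).measurable }
  have hsol : ∀ z : ℂ, 0 < z.im → SolvesQVE a S z (hfam.stieltjes z) := fun z hz =>
    solvesQVE_stieltjes hS ha hfam hlt hmom hz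
  have hvfin : ∀ x, IsFiniteMeasure (ENNReal.ofReal Real.pi • ν x) := fun x =>
    Measure.smul_finite _ ENNReal.ofReal_ne_top
  let v : X → FiniteMeasure ℝ := fun x => ⟨ENNReal.ofReal Real.pi • ν x, hvfin x⟩
  have hv : ∀ x, (v x : Measure ℝ) = ENNReal.ofReal Real.pi • ν x := fun x => rfl
  have hvnull : ∀ x ρ, R < ρ → (v x : Measure ℝ) (Icc (-ρ) ρ)ᶜ = 0 := fun x ρ hρ => by
    rw [hv, Measure.smul_apply, hnull x ρ hρ, smul_zero]
  have hvuniv : ∀ x, (v x : Measure ℝ) univ = ENNReal.ofReal Real.pi := fun x => by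
    rw [hv, Measure.smul_apply, huniv, smul_eq_mul, mul_one]
  refine ⟨hfam.stieltjes, fun z hz => ⟨hsol z hz, fun u hu => hu.unique ha hS hz (hsol z hz)⟩,
    hfam.analyticOnNhd_stieltjes, v, fun x => ?_, hvuniv, fun x z hz => ?_, ?_, fun h0 => ⟨?_, ?_⟩⟩
  · intro t ht
    -- Only radii `ρ > R` are available; the closed interval of radius `R` is their intersection.
    have h1 : ∀ ρ, R < ρ → t ∈ Icc (-ρ) ρ := fun ρ hρ =>
      Measure.support_subset_of_isClosed isClosed_Icc (hvnull x ρ hρ) ht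
    exact abs_le.1 (le_of_forall_gt_imp_ge_of_dense fun ρ hρ => abs_le.2 (h1 ρ hρ))
  · rw [hfam.stieltjes_apply hz, hv, integral_smul_measure, ENNReal.toReal_ofReal Real.pi_pos.le,
      Complex.real_smul, ← mul_assoc, one_div_mul_cancel, one_mul]
    exact Complex.ofReal_ne_zero.2 Real.pi_ne_zero
  · refine measurable_finiteMeasure_of_moments (B := Real.pi) (fun x => hvnull x _ hlt)
      (fun x => ?_) fun k => ?_
    · rw [measureReal_def, hvuniv, ENNReal.toReal_ofReal Real.pi_pos.le]
    · simp only [hv, integral_smul_measure, smul_eq_mul]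
      exact (hfam.meas k).const_mul _
  · intro z hz
    have h1 := hsol z hz
    rw [h0] at h1
    exact ⟨BMeas.memLp _ 2, h1.eLpNorm_two_le hS hz⟩
  · intro x A hA
    rw [hv, Measure.smul_apply, Measure.smul_apply,
      Measure.neg_eq_of_odd_moments_eq_zero (hnull x _ hlt) (fun k => ?_) hA]
    rw [hmom, qveMoment_odd_eq_zero h0, BMeas.zero_apply, Complex.zero_re]
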